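/- Theorem. Let $\mathfrak g=\mathfrak{sl}_2(\mathbb R)$ with standard basis $h=\begin{pmatrix}1&0\\0&-1\end{pmatrix}$, $x=\begin{pmatrix}0&1\\0&0\end{pmatrix}$, $y=\begin{pmatrix}0&0\\1&0\end{pmatrix}$, let $K=\mathsf{SO}_2(\mathbb R)$, and let $c=h^2-2h+4xy\in U(\mathfrak g)$ be the Casimir element. Let $V_0=\mathbb R$ be the trivial representation of $K$ and, for $n\ge 1$, let $V_n=\mathbb R^2$ with $k\in K$ acting by $v\mapsto k^nv$. A real Harish-Chandra $(\mathfrak g,K)$-module is a real vector space $M$ that carries a structure of a finitely generated $U(\mathfrak g)$-module and a representation of $K$ which is isomorphic to $\bigoplus_{n\ge 0}V_n^{\oplus m_n}$ with finite multiplicities $m_n$, such that $$\left.\tfrac{d}{dt}\right|_{t=0}\exp(tz)\cdot v=z\circ v\qquad\text{and}\qquad \mathsf{Ad}_k(a)\circ v=k\cdot\bigl(a\circ(k^{-1}\cdot v)\bigr)$$ for all $z\in\mathfrak{so}_2(\mathbb R)$, $a\in\mathfrak g$, $k\in K$, $v\in M$. Morphisms are the $\mathbb R$-linear maps that commute with $U(\mathfrak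 g)$ and $K$. Let $\mathsf{HC}_\circ(\mathfrak g,K)$ be the principal block, i.e. the full subcategory of those Harish-Chandra modules $M$ for which $c^mM=0$ for some $m\in\mathbb N$ (depending on $M$) and on which $-1\in K$ acts as the identity (equivalently, $m_n=0$ for all odd $n$). Let $R=\mathbb R[\![t]\!]$, $\mathfrak m=(t)$, and let $A$ be the real Gelfand order, i.e. the $\mathbb R$-algebra of all $3\times 3$ matrices $(a_{ij})$ over $R$ with $a_{13},a_{23}\in\mathfrak m$, $a_{11}(0)=a_{22}(0)$ and $a_{21}(0)=-a_{12}(0)$. Let $\mathsf{Rep}(A)$ be the category of $A$-modules that are finite-dimensional over $\mathbb R$. Then $\mathsf{HC}_\circ(\mathfrak g,K)$ and $\mathsf{Rep}(A)$, with their natural $\mathbb R$-linear structures, are abelian categories, and there is an $\mathbb R$-linear equivalence of categories $\mathsf{HC}_\circ(\mathfrak g,K)\simeq\mathsf{Rep}(A)$. -/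

import Mathlib

open CategoryTheory

universe u

noncomputable section

namespace RealGelfand

open Matrix
open scoped DirectSum ModuleCat

attribute [local instance] LieRing.ofAssociativeRing

/-! ## The real Gelfand order and its finite-dimensional modules -/

/-- The real Gelfand order: the `ℝ`-algebra of all `3 × 3` matrices `a` over `R = ℝ⟦t⟧` with
`a₁₃, a₂₃ ∈ (t)`, `a₁₁(0) = a₂₂(0)` and `a₂₁(0) = - a₁₂(0)` (rows and columns are numbered from `0`
in the code). -/
def gelfandOrder : Subalgebra ℝ (Matrix (Fin 3) (Fin 3) (PowerSeries ℝ)) where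
  carrier := {a | PowerSeries.constantCoeff (a 0 2) = 0 ∧ PowerSeries.constantCoeff (a 1 2) = 0 ∧
    PowerSeries.constantCoeff (a 0 0) = PowerSeries.constantCoeff (a 1 1) ∧
    PowerSeries.constantCoeff (a 1 0) = - PowerSeries.constantCoeff (a 0 1)}
  mul_mem' := by
    rintro a b ⟨h1, h2, h3, h4⟩ ⟨k1, k2, k3, k4⟩
    refine ⟨?_, ?_, ?_, ?_⟩ <;>
      simp only [Matrix.mul_apply, Fin.sum_univ_three, map_add, map_mul, h1, h2, h3, h4,
        k1, k2, k3, k4] <;> ring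
  add_mem' := by
    rintro a b ⟨h1, h2, h3, h4⟩ ⟨k1, k2, k3, k4⟩
    refine ⟨?_, ?_, ?_, ?_⟩ <;>
      simp only [Matrix.add_apply, map_add, h1, h2, h3, h4, k1, k2, k3, k4] <;> ring
  algebraMap_mem' := by
    intro r
    refine ⟨?_, ?_, ?_, ?_⟩ <;> simp [Matrix.algebraMap_matrix_apply]

/-- An `A`-module is finite-dimensional if it is so as a real vector space
(the real structure being the restriction of scalars along `ℝ → A`). -/
def isFiniteDimensional : ObjectProperty (ModuleCat.{u} gelfandOrder) :=
  fun M => FiniteDimensional ℝ M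

/-- `Rep(A)`: the category of finite-dimensional modules over the real Gelfand order. -/
abbrev RepA : Type (u + 1) := (isFiniteDimensional.{u}).FullSubcategory

/-! ## The pair `(𝔤, K) = (sl₂(ℝ), SO₂(ℝ))` -/

/-- `𝔤 = sl₂(ℝ)`. -/
abbrev 𝔤 : LieSubalgebra ℝ (Matrix (Fin 2) (Fin 2) ℝ) := LieAlgebra.SpecialLinear.sl (Fin 2) ℝ

/-- `U(𝔤)`. -/
abbrev U𝔤 : Type := UniversalEnvelopingAlgebra ℝ 𝔤

/-- The canonical map `𝔤 → U(𝔤)`. -/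
abbrev ι𝔤 : 𝔤 →ₗ⁅ℝ⁆ U𝔤 := UniversalEnvelopingAlgebra.ι ℝ

/-- `K = SO₂(ℝ)`. -/
abbrev K : Type := Matrix.specialOrthogonalGroup (Fin 2) ℝ

/-- The adjoint action of `K ⊆ SL₂(ℝ)` on `𝔤`. -/
def Ad (k : K) (a : 𝔤) : 𝔤 :=
  ⟨(k : Matrix (Fin 2) (Fin 2) ℝ) * (a : Matrix (Fin 2) (Fin 2) ℝ) *
      ((k⁻¹ : K) : Matrix (Fin 2) (Fin 2) ℝ), by
    change Matrix.trace (_ : Matrix (Fin 2) (Fin 2) ℝ) = 0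
    have h : ((k⁻¹ : K) : Matrix (Fin 2) (Fin 2) ℝ) * (k : Matrix (Fin 2) (Fin 2) ℝ) = 1 := by
      rw [← Submonoid.coe_mul, inv_mul_cancel, Submonoid.coe_one]
    have ha : Matrix.trace (a : Matrix (Fin 2) (Fin 2) ℝ) = 0 := a.2
    rw [Matrix.trace_mul_comm, ← Matrix.mul_assoc, h, Matrix.one_mul,
      ha]⟩

theorem exp_mem (z : Matrix (Fin 2) (Fin 2) ℝ) (hz : zᵀ = -z) :
    NormedSpace.exp z ∈ Matrix.specialOrthogonalGroup (Fin 2) ℝ := by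
  have horth : ∀ w : Matrix (Fin 2) (Fin 2) ℝ, wᵀ = -w →
      NormedSpace.exp w * (NormedSpace.exp w)ᵀ = 1 := by
    intro w hw
    rw [← Matrix.exp_transpose, hw, Matrix.exp_neg]
    exact Matrix.mul_nonsing_inv _ ((Matrix.isUnit_iff_isUnit_det _).1 (Matrix.isUnit_exp w))
  rw [Matrix.mem_specialOrthogonalGroup_iff, Matrix.mem_orthogonalGroup_iff]
  refine ⟨by simpa [Matrix.star_eq_conjTranspose] using horth z hz, ?_⟩
  have hw : ((1 / 2 : ℝ) • z)ᵀ = -((1 / 2 : ℝ) • z) := by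
    rw [Matrix.transpose_smul, hz, smul_neg]
  have h2 : z = (2 : ℕ) • ((1 / 2 : ℝ) • z) := by
    rw [← Nat.cast_smul_eq_nsmul ℝ, smul_smul]; norm_num
  have h3 := congrArg Matrix.det (horth _ hw)
  rw [Matrix.det_mul, Matrix.det_transpose, Matrix.det_one] at h3
  rw [h2, Matrix.exp_nsmul, Matrix.det_pow, pow_two, h3]

/-- `exp (t z) ∈ K`, for `z` in the Lie algebra `so₂(ℝ) ⊆ 𝔤` of `K` and `t ∈ ℝ`. -/
def expK (z : 𝔤) (hz : (z : Matrix (Fin 2) (Fin 2) ℝ)ᵀ = -(z : Matrix (Fin 2) (Fin 2) ℝ)) (t : ℝ) :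
    K :=
  ⟨NormedSpace.exp (t • (z : Matrix (Fin 2) (Fin 2) ℝ)),
    exp_mem _ (by rw [Matrix.transpose_smul, hz, smul_neg])⟩

theorem K_comm (k l : K) : k * l = l * k := by
  obtain ⟨hk1, hk2, -⟩ := Matrix.mem_specialOrthogonalGroup_fin_two_iff.1 k.2
  obtain ⟨hl1, hl2, -⟩ := Matrix.mem_specialOrthogonalGroup_fin_two_iff.1 l.2
  apply Subtype.ext
  ext i j
  fin_cases i <;> fin_cases j <;>
    simp [Matrix.mul_apply, hk1, hk2, hl1, hl2] <;> ring

/-- The space of the irreducible real representation `V_n` of `K`. -/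
def KType : ℕ → Type
  | 0 => ℝ
  | _ + 1 => Fin 2 → ℝ

instance : (n : ℕ) → AddCommGroup (KType n)
  | 0 => inferInstanceAs (AddCommGroup ℝ)
  | _ + 1 => inferInstanceAs (AddCommGroup (Fin 2 → ℝ))

instance : (n : ℕ) → Module ℝ (KType n)
  | 0 => inferInstanceAs (Module ℝ ℝ)
  | _ + 1 => inferInstanceAs (Module ℝ (Fin 2 → ℝ))

/-- The irreducible real representations of `K`: `V₀ = ℝ` is trivial, and for `n ≥ 1` an element
`k ∈ K` acts on `V_n = ℝ²` by `v ↦ kⁿ v`. -/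
def kTypeRep : (n : ℕ) → Representation ℝ K (KType n)
  | 0 => (1 : K →* Module.End ℝ ℝ)
  | n + 1 =>
    { toFun := fun k =>
        (Matrix.toLin' ((k ^ (n + 1) : K) : Matrix (Fin 2) (Fin 2) ℝ) :
          Module.End ℝ (Fin 2 → ℝ))
      map_one' := by
        rw [one_pow, Submonoid.coe_one, Matrix.toLin'_one]; rfl
      map_mul' := fun k l => by
        rw [(show Commute k l from K_comm k l).mul_pow, Submonoid.coe_mul, Matrix.toLin'_mul]; rfl }

/-- A real representation of `K` is admissible if it is isomorphic to `⨁ₙ V_n ^ (m n)`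
with finite multiplicities `m n`. -/
def IsAdmissible {M : Type u} [AddCommGroup M] [Module ℝ M] (ρ : Representation ℝ K M) : Prop :=
  ∃ (m : ℕ → ℕ) (e : M ≃ₗ[ℝ] ⨁ n : ℕ, (Fin (m n) → KType n)),
    ∀ (k : K) (v : M) (n : ℕ) (j : Fin (m n)), e (ρ k v) n j = kTypeRep n k (e v n j)

/-! ## Harish-Chandra modules -/

/-- Real Harish-Chandra `(𝔤, K)`-modules. The derivative of `t ↦ exp (t z) v` at `t = 0` is taken
along every linear functional; since `M` is a direct sum of finite-dimensional representations of
`K`, this is the usual derivative in a finite-dimensional `K`-stable subspace that contains `v`. -/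
structure HCModule : Type (u + 1) where
  carrier : Type u
  [addCommGroup : AddCommGroup carrier]
  [moduleReal : Module ℝ carrier]
  [moduleU : Module U𝔤 carrier]
  [isScalarTower : IsScalarTower ℝ U𝔤 carrier]
  ρ : Representation ℝ K carrier
  finite : Module.Finite U𝔤 carrier
  admissible : IsAdmissible ρ
  deriv_exp : ∀ (z : 𝔤)
    (hz : (z : Matrix (Fin 2) (Fin 2) ℝ)ᵀ = -(z : Matrix (Fin 2) (Fin 2) ℝ))
    (v : carrier) (φ : Module.Dual ℝ carrier),
    HasDerivAt (fun t : ℝ => φ (ρ (expK z hz t) v)) (φ (ι𝔤 z • v)) 0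
  ad_smul : ∀ (k : K) (a : 𝔤) (v : carrier), ι𝔤 (Ad k a) • v = ρ k (ι𝔤 a • ρ k⁻¹ v)

attribute [instance] HCModule.addCommGroup HCModule.moduleReal HCModule.moduleU
  HCModule.isScalarTower

namespace HCModule

/-- The morphisms of Harish-Chandra modules as a real subspace of the `U(𝔤)`-linear maps:
those that commute with `K`. -/
def homSubmodule (M N : HCModule.{u}) : Submodule ℝ (M.carrier →ₗ[ℝ] N.carrier) where
  carrier := {f | (∀ (a : U𝔤) (v : M.carrier), f (a • v) = a • f v) ∧
    ∀ (k : K) (v : M.carrier), f (M.ρ k v) = N.ρ k (f v)}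
  add_mem' := by
    rintro f g ⟨hf, hf'⟩ ⟨hg, hg'⟩
    exact ⟨fun a v => by simp [hf, hg], fun k v => by simp [hf', hg']⟩
  zero_mem' := ⟨fun a v => by simp, fun k v => by simp⟩
  smul_mem' := by
    rintro r f ⟨hf, hf'⟩
    exact ⟨fun a v => by simp [hf, smul_algebra_smul_comm], fun k v => by simp [hf']⟩

/-- The category `HC(𝔤, K)`: morphisms are the linear maps commuting with `U(𝔤)` and with `K`. -/
instance : Category (HCModule.{u}) where
  Hom M N := homSubmodule M N
  id M := ⟨LinearMap.id, ⟨fun _ _ => rfl, fun _ _ => rfl⟩⟩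
  comp f g := ⟨g.1.comp f.1, ⟨fun a v => by simp [f.2.1, g.2.1], fun k v => by simp [f.2.2, g.2.2]⟩⟩

instance : Preadditive (HCModule.{u}) where
  homGroup M N := inferInstanceAs (AddCommGroup (homSubmodule M N))
  add_comp _ _ _ f f' g := Subtype.ext (LinearMap.comp_add f.1 f'.1 g.1)
  comp_add _ _ _ f g g' := Subtype.ext (LinearMap.add_comp f.1 g'.1 g.1)

instance : Linear ℝ (HCModule.{u}) where
  homModule M N := inferInstanceAs (Module ℝ (homSubmodule M N))
  smul_comp _ _ _ r f g := Subtype.ext (LinearMap.comp_smul g.1 r f.1)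
  comp_smul _ _ _ f r g := Subtype.ext (LinearMap.smul_comp r g.1 f.1)

end HCModule

/-! ## The principal block -/

theorem hMat_mem : !![1, 0; 0, -1] ∈ 𝔤 := by
  change Matrix.trace (_ : Matrix (Fin 2) (Fin 2) ℝ) = 0
  simp [Matrix.trace_fin_two]

theorem xMat_mem : !![0, 1; 0, 0] ∈ 𝔤 := by
  change Matrix.trace (_ : Matrix (Fin 2) (Fin 2) ℝ) = 0
  simp [Matrix.trace_fin_two]

theorem yMat_mem : !![0, 0; 1, 0] ∈ 𝔤 := by
  change Matrix.trace (_ : Matrix (Fin 2) (Fin 2) ℝ) = 0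
  simp [Matrix.trace_fin_two]

/-- The element `h` of the standard basis of `𝔤`. -/
def hElt : 𝔤 := ⟨!![1, 0; 0, -1], hMat_mem⟩

/-- The element `x` of the standard basis of `𝔤`. -/
def xElt : 𝔤 := ⟨!![0, 1; 0, 0], xMat_mem⟩

/-- The element `y` of the standard basis of `𝔤`. -/
def yElt : 𝔤 := ⟨!![0, 0; 1, 0], yMat_mem⟩

/-- The Casimir element `c = h² - 2h + 4xy` of `U(𝔤)`. -/
def casimir : U𝔤 := ι𝔤 hElt ^ 2 - 2 * ι𝔤 hElt + 4 * (ι𝔤 xElt * ι𝔤 yElt)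

/-- The element `-1` of `K`. -/
def negOne : K := ⟨-1, by
  rw [Matrix.mem_specialOrthogonalGroup_iff, Matrix.mem_orthogonalGroup_iff]
  simp [Matrix.det_neg]⟩

/-- The objects of the principal block of `HC(𝔤, K)`, i.e. of the block of the trivial module:
those on which a power of the Casimir element vanishes and all of whose `K`-types are even (that is,
`-1 ∈ K` acts as the identity). -/
def isPrincipal : ObjectProperty HCModule.{u} := fun M =>
  (∃ m : ℕ, ∀ v : M.carrier, casimir ^ m • v = 0) ∧ ∀ v : M.carrier, M.ρ negOne v = v

/-- The principal block `HC_∘(𝔤, K)`. -/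
abbrev PrincipalBlock : Type (u + 1) := (isPrincipal.{u}).FullSubcategory

end RealGelfand

end

/-! Both categories are shown to be equivalent to a category of linear algebra data, `GelfandDatum`:
tuples (N0, W, J, P, Q) forming a real version of the nilpotent representations of the Gelfand
quiver.

Harish-Chandra side. Put u = x - y and s = x + y. The part of K-type n is the space where u² = -n²,
and in the principal block only even n occur. Let N0 and W be the parts of K-type 0 and 2, J = u/2,
P the restriction of h to N0, and Q the lowering operator from W to N0. Since [h, s] = 2u kills N0,
QJP = 0. The Casimir element c is 2QP on N0 and 2T on W, where T = PQ - JPQJ, so both are nilpotent.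
Higher K-types carry no further information: on K-type m, lowering after raising is (c - m(m+2))/4
(`down_up`), invertible for m ≥ 2 because c is nilpotent, and similarly in the other order
(`up_down`). Raising therefore identifies the parts of K-type 2, 4, 6, ... with W, and the action of
h, s, u on N0 ⊕ W ⊕ W ⊕ ... is forced. This yields the explicit module `Ind` and the isomorphism
`Realization.comparison`. For m = 0 the scalar m(m+2) vanishes, which is why P and Q need not be
invertible.

Order side (indices from 0). The idempotent e = E₂₂ splits a module V as W ⊕ N0 with W = (1 - e)V
and N0 = eV, while E₀₁ - E₁₀, X E₀₂ and E₂₀ give J, P and Q. The scalar X equals PQ - JPQJ + QP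
(`scal_X`), so it acts by T on W and by QP on N0. It is nilpotent on every finite-dimensional module
(`exists_scal_X_pow_smul`), so a power series acts through a polynomial and these four elements
determine the action. Conversely a datum defines an action of all matrices; multiplicativity is
`coordAction_comp`.

`RepA` is abelian because finite-dimensionality passes to subobjects, quotients and finite products;
the structure is transported to the principal block. -/

noncomputable section

namespace RealGelfand

open Matrix
open scoped DirectSum ModuleCat

attribute [local instance] LieRing.ofAssociativeRing

/-! ## The group `K` and the complex character `χ` -/

/-- The character `K → ℂ` that identifies `K` with the unit circle. -/
def chi : K →* ℂ where
  toFun k := ⟨k.1 0 0, k.1 0 1⟩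
  map_one' := by apply Complex.ext <;> simp
  map_mul' k l := by
    obtain ⟨hk1, hk2, -⟩ := Matrix.mem_specialOrthogonalGroup_fin_two_iff.1 k.2
    obtain ⟨hl1, hl2, -⟩ := Matrix.mem_specialOrthogonalGroup_fin_two_iff.1 l.2
    apply Complex.ext
    · simp [Matrix.mul_apply, hk1, hk2, hl1, hl2]
      ring
    · simp [Matrix.mul_apply, hk1, hk2, hl1, hl2]

theorem chi_re (k : K) : (chi k).re = k.1 0 0 := rfl

theorem chi_im (k : K) : (chi k).im = k.1 0 1 := rfl

theorem coe_eq_chi (k : K) :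
    (k : Matrix (Fin 2) (Fin 2) ℝ) = !![(chi k).re, (chi k).im; -(chi k).im, (chi k).re] := by
  obtain ⟨hk1, hk2, -⟩ := Matrix.mem_specialOrthogonalGroup_fin_two_iff.1 k.2
  ext i j
  fin_cases i <;> fin_cases j <;> simp [chi_re, chi_im, hk1, hk2]

theorem chi_norm (k : K) : (chi k).re ^ 2 + (chi k).im ^ 2 = 1 :=
  (Matrix.mem_specialOrthogonalGroup_fin_two_iff.1 k.2).2.2

theorem chi_mul_conj (k : K) : chi k * (starRingEnd ℂ) (chi k) = 1 := by
  rw [Complex.mul_conj, Complex.normSq_apply]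
  exact_mod_cast (by have := chi_norm k; nlinarith)

theorem chi_ne_zero (k : K) : chi k ≠ 0 := left_ne_zero_of_mul_eq_one (chi_mul_conj k)

theorem chi_inv (k : K) : chi k⁻¹ = (starRingEnd ℂ) (chi k) := by
  apply mul_left_cancel₀ (chi_ne_zero k)
  rw [chi_mul_conj, ← map_mul, mul_inv_cancel, map_one]

theorem chi_negOne : chi negOne = -1 := by
  apply Complex.ext <;> simp [chi, negOne]

/-- The embedding of the complex numbers in the real `2 × 2` matrices that is inverse to `chi`. -/
def complexToMatrix : ℂ →ₐ[ℝ] Matrix (Fin 2) (Fin 2) ℝ :=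
  Complex.liftAux !![0, 1; -1, 0] (by ext i j; fin_cases i <;> fin_cases j <;> simp)

theorem complexToMatrix_apply (z : ℂ) : complexToMatrix z = !![z.re, z.im; -z.im, z.re] := by
  rw [complexToMatrix, Complex.liftAux_apply]
  ext i j
  fin_cases i <;> fin_cases j <;> simp [Matrix.algebraMap_matrix_apply]

/-- A continuous algebra homomorphism commutes with the exponential series; the norm on matrices
serves only to supply convergence. -/
theorem exp_complexToMatrix (z : ℂ) :
    NormedSpace.exp (complexToMatrix z) = complexToMatrix (Complex.exp z) := by
  let _ : NormedRing (Matrix (Fin 2) (Fin 2) ℝ) := Matrix.linftyOpNormedRing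
  let _ : NormedAlgebra ℝ (Matrix (Fin 2) (Fin 2) ℝ) := Matrix.linftyOpNormedAlgebra
  rw [Complex.exp_eq_exp_ℂ]
  exact (NormedSpace.map_exp complexToMatrix
    (complexToMatrix.toLinearMap.continuous_of_finiteDimensional) z).symm

/-! ## The Lie algebra `𝔤` -/

/-- The generator `x - y` of the Lie algebra `so₂(ℝ)`. -/
def uElt : 𝔤 := xElt - yElt

/-- The element `x + y` of `𝔤`. -/
def sElt : 𝔤 := xElt + yElt

theorem coe_uElt : (uElt : Matrix (Fin 2) (Fin 2) ℝ) = !![0, 1; -1, 0] := by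
  ext i j; fin_cases i <;> fin_cases j <;> simp [uElt, xElt, yElt]

theorem coe_sElt : (sElt : Matrix (Fin 2) (Fin 2) ℝ) = !![0, 1; 1, 0] := by
  ext i j; fin_cases i <;> fin_cases j <;> simp [sElt, xElt, yElt]

theorem coe_hElt : (hElt : Matrix (Fin 2) (Fin 2) ℝ) = !![1, 0; 0, -1] := rfl

theorem trace_g (z : 𝔤) : z.1 1 1 = - z.1 0 0 := by
  have h : Matrix.trace (z : Matrix (Fin 2) (Fin 2) ℝ) = 0 := z.2
  rw [Matrix.trace_fin_two] at h
  linarith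

theorem eq_combination (z : 𝔤) :
    z = z.1 0 0 • hElt + ((z.1 0 1 + z.1 1 0) / 2) • sElt + ((z.1 0 1 - z.1 1 0) / 2) • uElt := by
  apply Subtype.ext
  have h := trace_g z
  ext i j
  fin_cases i <;> fin_cases j <;> simp [coe_uElt, coe_sElt, coe_hElt, h] <;> ring

/-- Because so₂ is a line, the condition on derivatives needs to be examined for `uElt` only. -/
theorem eq_smul_uElt (z : 𝔤)
    (hz : (z : Matrix (Fin 2) (Fin 2) ℝ)ᵀ = -(z : Matrix (Fin 2) (Fin 2) ℝ)) :
    z = z.1 0 1 • uElt := by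
  have h00 := congrFun (congrFun hz 0) 0
  have h01 := congrFun (congrFun hz 0) 1
  simp only [Matrix.transpose_apply, Matrix.neg_apply] at h00 h01
  have h0 : z.1 0 0 = 0 := by linarith
  conv_lhs => rw [eq_combination z, h0, h01]
  rw [zero_smul, add_neg_cancel, zero_div, zero_smul, zero_add, zero_add]
  congr 1
  ring

theorem uElt_skew : (uElt : Matrix (Fin 2) (Fin 2) ℝ)ᵀ = -(uElt : Matrix (Fin 2) (Fin 2) ℝ) := by
  rw [coe_uElt]; ext i j; fin_cases i <;> fin_cases j <;> simp

theorem chi_expK (z : 𝔤)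
    (hz : (z : Matrix (Fin 2) (Fin 2) ℝ)ᵀ = -(z : Matrix (Fin 2) (Fin 2) ℝ)) (t : ℝ) :
    chi (expK z hz t) = Complex.exp ((t * z.1 0 1 : ℝ) * Complex.I) := by
  have h : t • (z : Matrix (Fin 2) (Fin 2) ℝ) =
      complexToMatrix ((t * z.1 0 1 : ℝ) * Complex.I) := by
    conv_lhs => rw [eq_smul_uElt z hz]
    rw [complexToMatrix_apply]
    ext i j
    fin_cases i <;> fin_cases j <;> simp [coe_uElt]
  have h2 : (expK z hz t : Matrix (Fin 2) (Fin 2) ℝ) =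
      complexToMatrix (Complex.exp ((t * z.1 0 1 : ℝ) * Complex.I)) := by
    rw [← exp_complexToMatrix, ← h]
    rfl
  rw [complexToMatrix_apply] at h2
  apply Complex.ext
  · rw [chi_re, h2]; simp
  · rw [chi_im, h2]; simp

/-- The basis h, s, u is adapted to the Cartan decomposition: u spans the Lie algebra of K, and ad u
rotates the plane of h and s with speed 2. Hence h and s shift K-types by 2. -/
theorem lie_u_h : ⁅uElt, hElt⁆ = (-2 : ℝ) • sElt := by
  apply Subtype.ext
  rw [LieSubalgebra.coe_bracket, coe_uElt, coe_hElt, LieRing.of_associative_ring_bracket]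
  ext i j
  fin_cases i <;> fin_cases j <;> norm_num [coe_sElt]

theorem lie_u_s : ⁅uElt, sElt⁆ = (2 : ℝ) • hElt := by
  apply Subtype.ext
  rw [LieSubalgebra.coe_bracket, coe_uElt, coe_sElt, LieRing.of_associative_ring_bracket]
  ext i j
  fin_cases i <;> fin_cases j <;> norm_num [coe_hElt]

theorem lie_h_s : ⁅hElt, sElt⁆ = (2 : ℝ) • uElt := by
  apply Subtype.ext
  rw [LieSubalgebra.coe_bracket, coe_hElt, coe_sElt, LieRing.of_associative_ring_bracket]
  ext i j
  fin_cases i <;> fin_cases j <;> norm_num [coe_uElt]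

theorem Ad_hElt (k : K) :
    Ad k hElt = ((chi k) ^ 2).re • hElt - ((chi k) ^ 2).im • sElt := by
  apply Subtype.ext
  simp only [Ad, coe_eq_chi, chi_inv]
  ext i j
  fin_cases i <;> fin_cases j <;> simp [coe_hElt, coe_sElt, pow_two] <;> ring

theorem Ad_sElt (k : K) :
    Ad k sElt = ((chi k) ^ 2).im • hElt + ((chi k) ^ 2).re • sElt := by
  apply Subtype.ext
  simp only [Ad, coe_eq_chi, chi_inv]
  ext i j
  fin_cases i <;> fin_cases j <;> simp [coe_hElt, coe_sElt, pow_two] <;> ring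

theorem Ad_uElt (k : K) : Ad k uElt = uElt := by
  apply Subtype.ext
  have := chi_norm k
  simp only [Ad, coe_eq_chi, chi_inv]
  ext i j
  fin_cases i <;> fin_cases j <;> simp [coe_uElt] <;> nlinarith

theorem Ad_add (k : K) (a b : 𝔤) : Ad k (a + b) = Ad k a + Ad k b := by
  apply Subtype.ext
  simp [Ad, Matrix.mul_add, Matrix.add_mul]

theorem Ad_smul (k : K) (r : ℝ) (a : 𝔤) : Ad k (r • a) = r • Ad k a := by
  apply Subtype.ext
  simp [Ad]

/-! ## The enveloping algebra -/

/-- By the universal property the inclusion of 𝔤 lifts to a map into `S`, and uniqueness makes this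
lift, followed by the inclusion of `S`, the identity. -/
theorem subalgebra_eq_top (S : Subalgebra ℝ U𝔤) (h : ∀ z, ι𝔤 z ∈ S) : S = ⊤ := by
  let f : 𝔤 →ₗ⁅ℝ⁆ S :=
    { toFun := fun z => ⟨ι𝔤 z, h z⟩
      map_add' := fun a b => Subtype.ext (map_add ι𝔤 a b)
      map_smul' := fun r a => Subtype.ext (map_smul ι𝔤 r a)
      map_lie' := fun {a b} => Subtype.ext (LieHom.map_lie ι𝔤 a b) }
  have hf : S.val.comp (UniversalEnvelopingAlgebra.lift ℝ f) = AlgHom.id ℝ U𝔤 := by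
    apply UniversalEnvelopingAlgebra.hom_ext
    ext z
    change S.val (UniversalEnvelopingAlgebra.lift ℝ f (ι𝔤 z)) = ι𝔤 z
    rw [UniversalEnvelopingAlgebra.lift_ι_apply]
    rfl
  rw [eq_top_iff]
  intro a _
  rw [← AlgHom.id_apply (R := ℝ) a, ← hf]
  exact (UniversalEnvelopingAlgebra.lift ℝ f a).2

theorem subalgebra_eq_top_of_hsu (S : Subalgebra ℝ U𝔤) (h1 : ι𝔤 hElt ∈ S) (h2 : ι𝔤 sElt ∈ S)
    (h3 : ι𝔤 uElt ∈ S) : S = ⊤ := by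
  apply subalgebra_eq_top
  intro z
  rw [eq_combination z]
  simp only [map_add, map_smul]
  exact S.add_mem (S.add_mem (S.smul_mem h1 _) (S.smul_mem h2 _)) (S.smul_mem h3 _)

theorem lie_U (a b : 𝔤) : ι𝔤 a * ι𝔤 b - ι𝔤 b * ι𝔤 a = ι𝔤 ⁅a, b⁆ := by
  rw [LieHom.map_lie, LieRing.of_associative_ring_bracket]

/-- The term -2h is what symmetrizes 4xy: 4xy - 2h = 2(xy + yx) = s² - u². -/
theorem casimir_eq :
    casimir = ι𝔤 hElt ^ 2 + ι𝔤 sElt ^ 2 - ι𝔤 uElt ^ 2 := by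
  have h : ⁅xElt, yElt⁆ = hElt := by
    apply Subtype.ext
    rw [LieSubalgebra.coe_bracket, LieRing.of_associative_ring_bracket]
    ext i j
    fin_cases i <;> fin_cases j <;> simp [xElt, yElt, hElt]
  have h2 := lie_U xElt yElt
  rw [h] at h2
  rw [casimir, sElt, uElt, ← h2]
  simp only [map_add, map_sub]
  noncomm_ring

theorem map_smul_U {M N : Type*} [AddCommGroup M] [AddCommGroup N] [Module ℝ M] [Module ℝ N]
    [Module U𝔤 M] [Module U𝔤 N] [IsScalarTower ℝ U𝔤 M] [IsScalarTower ℝ U𝔤 N] (f : M →ₗ[ℝ] N)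
    (h1 : ∀ v, f (ι𝔤 hElt • v) = ι𝔤 hElt • f v) (h2 : ∀ v, f (ι𝔤 sElt • v) = ι𝔤 sElt • f v)
    (h3 : ∀ v, f (ι𝔤 uElt • v) = ι𝔤 uElt • f v) (a : U𝔤) (v : M) : f (a • v) = a • f v := by
  let S : Subalgebra ℝ U𝔤 :=
    { carrier := {a | ∀ v, f (a • v) = a • f v}
      mul_mem' := fun {a b} ha hb v => by
        rw [mul_smul, ha, hb, mul_smul]
      add_mem' := fun {a b} ha hb v => by
        rw [add_smul, map_add, ha, hb, add_smul]
      algebraMap_mem' := fun r v => by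
        rw [algebraMap_smul, algebraMap_smul, map_smul] }
  have : a ∈ S := by rw [subalgebra_eq_top_of_hsu S h1 h2 h3]; trivial
  exact this v

/-! ## The category of Gelfand data -/

/-- Finite-dimensional nilpotent representations of the real form of the Gelfand quiver: a real
space `N0`, a space `W` with a complex structure `J`, and linear maps `P : N0 → W` and
`Q : W → N0` such that `Q J P = 0` and `Q P` is nilpotent. -/
structure GelfandDatum : Type (u + 1) where
  N0 : Type u
  W : Type u
  [addCommGroupN0 : AddCommGroup N0]
  [moduleN0 : Module ℝ N0]
  [finiteN0 : FiniteDimensional ℝ N0]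
  [addCommGroupW : AddCommGroup W]
  [moduleW : Module ℝ W]
  [finiteW : FiniteDimensional ℝ W]
  J : W →ₗ[ℝ] W
  P : N0 →ₗ[ℝ] W
  Q : W →ₗ[ℝ] N0
  J_J : ∀ w, J (J w) = -w
  Q_J_P : ∀ n, Q (J (P n)) = 0
  nilpotent : ∃ m : ℕ, ∀ n, ((Q ∘ₗ P) ^ m) n = 0

namespace GelfandDatum

attribute [instance] addCommGroupN0 moduleN0 finiteN0 addCommGroupW moduleW finiteW

attribute [simp] J_J Q_J_P

/-- The morphisms of Gelfand data, as a real subspace of the pairs of linear maps. -/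
def homSubmodule (D E : GelfandDatum.{u}) : Submodule ℝ ((D.N0 →ₗ[ℝ] E.N0) × (D.W →ₗ[ℝ] E.W)) where
  carrier := {f | (∀ w, f.2 (D.J w) = E.J (f.2 w)) ∧
    (∀ n, f.2 (D.P n) = E.P (f.1 n)) ∧ ∀ w, f.1 (D.Q w) = E.Q (f.2 w)}
  add_mem' := by
    rintro f g ⟨hf, hf', hf''⟩ ⟨hg, hg', hg''⟩
    exact ⟨fun w => by simp [hf, hg], fun n => by simp [hf', hg'], fun w => by simp [hf'', hg'']⟩
  zero_mem' := ⟨fun w => by simp, fun n => by simp, fun w => by simp⟩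
  smul_mem' := by
    rintro r f ⟨hf, hf', hf''⟩
    exact ⟨fun w => by simp [hf], fun n => by simp [hf'], fun w => by simp [hf'']⟩

instance : Category GelfandDatum.{u} where
  Hom D E := homSubmodule D E
  id D := ⟨(LinearMap.id, LinearMap.id), fun _ => rfl, fun _ => rfl, fun _ => rfl⟩
  comp f g := ⟨(g.1.1.comp f.1.1, g.1.2.comp f.1.2), fun w => by simp [f.2.1, g.2.1],
    fun n => by simp [f.2.2.1, g.2.2.1], fun w => by simp [f.2.2.2, g.2.2.2]⟩

instance : Preadditive GelfandDatum.{u} where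
  homGroup D E := inferInstanceAs (AddCommGroup (homSubmodule D E))
  add_comp _ _ _ f f' g := Subtype.ext (Prod.ext (LinearMap.comp_add f.1.1 f'.1.1 g.1.1)
    (LinearMap.comp_add f.1.2 f'.1.2 g.1.2))
  comp_add _ _ _ f g g' := Subtype.ext (Prod.ext (LinearMap.add_comp f.1.1 g'.1.1 g.1.1)
    (LinearMap.add_comp f.1.2 g'.1.2 g.1.2))

instance : Linear ℝ GelfandDatum.{u} where
  homModule D E := inferInstanceAs (Module ℝ (homSubmodule D E))
  smul_comp _ _ _ r f g := Subtype.ext (Prod.ext (LinearMap.comp_smul g.1.1 r f.1.1)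
    (LinearMap.comp_smul g.1.2 r f.1.2))
  comp_smul _ _ _ f r g := Subtype.ext (Prod.ext (LinearMap.smul_comp r g.1.1 f.1.1)
    (LinearMap.smul_comp r g.1.2 f.1.2))

@[ext]
theorem hom_ext {D E : GelfandDatum.{u}} {f g : D ⟶ E} (h1 : ∀ n, f.1.1 n = g.1.1 n)
    (h2 : ∀ w, f.1.2 w = g.1.2 w) : f = g :=
  Subtype.ext (Prod.ext (LinearMap.ext h1) (LinearMap.ext h2))

variable (D E : GelfandDatum.{u})

/-- The action of the complex numbers on `W`. -/
def cx : ℂ →ₐ[ℝ] Module.End ℝ D.W :=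
  Complex.liftAux D.J (LinearMap.ext fun w => by simp)

theorem cx_apply (z : ℂ) (w : D.W) : D.cx z w = z.re • w + z.im • D.J w := by
  simp [cx, Complex.liftAux_apply]

theorem cx_mul (z z' : ℂ) (w : D.W) : D.cx (z * z') w = D.cx z (D.cx z' w) := by
  rw [map_mul]; rfl

/-- The complex-linear part of `P Q`, up to a factor `2`. -/
def T : D.W →ₗ[ℝ] D.W := D.P ∘ₗ D.Q - D.J ∘ₗ D.P ∘ₗ D.Q ∘ₗ D.J

theorem T_apply (w : D.W) : D.T w = D.P (D.Q w) - D.J (D.P (D.Q (D.J w))) := rfl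

theorem T_J (w : D.W) : D.T (D.J w) = D.J (D.T w) := by
  simp [T_apply, add_comm]

theorem T_P (n : D.N0) : D.T (D.P n) = D.P (D.Q (D.P n)) := by
  simp [T_apply]

theorem Q_T (w : D.W) : D.Q (D.T w) = D.Q (D.P (D.Q w)) := by
  simp [T_apply]

theorem T_pow_P (k : ℕ) (n : D.N0) : (D.T ^ k) (D.P n) = D.P (((D.Q ∘ₗ D.P) ^ k) n) := by
  induction k generalizing n with
  | zero => rfl
  | succ k ih => rw [pow_succ, Module.End.mul_apply, T_P, ih, pow_succ]; rfl

theorem T_pow_J (k : ℕ) (w : D.W) : (D.T ^ k) (D.J w) = D.J ((D.T ^ k) w) := by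
  induction k generalizing w with
  | zero => rfl
  | succ k ih => rw [pow_succ, Module.End.mul_apply, T_J, ih]; rfl

/-- The image of T lies in P(N0) + J P(N0). On P(N0) the powers of T are those of QP, and T commutes
with J. -/
theorem T_nilpotent : ∃ m : ℕ, D.T ^ m = 0 := by
  obtain ⟨m, hm⟩ := D.nilpotent
  refine ⟨m + 1, LinearMap.ext fun w => ?_⟩
  rw [pow_succ, Module.End.mul_apply, T_apply, map_sub, T_pow_J, T_pow_P, T_pow_P, hm, hm]
  simp

variable {D E}

theorem hom_T (f : D ⟶ E) (w : D.W) : f.1.2 (D.T w) = E.T (f.1.2 w) := by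
  simp [T_apply, f.2.1, f.2.2.1, f.2.2.2]

theorem hom_cx (f : D ⟶ E) (z : ℂ) (w : D.W) : f.1.2 (D.cx z w) = E.cx z (f.1.2 w) := by
  simp [cx_apply, f.2.1]

end GelfandDatum

/-! ## The Harish-Chandra module of a Gelfand datum -/

/-- The linear endomorphism of the finitely supported sequences that acts by `φ j` on the `j`-th
entry. -/
def pointwise {W : Type*} [AddCommGroup W] [Module ℝ W] (φ : ℕ → W →ₗ[ℝ] W) :
    (ℕ →₀ W) →ₗ[ℝ] (ℕ →₀ W) where
  toFun f := Finsupp.onFinset f.support (fun j => φ j (f j)) fun j hj => by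
    rw [Finsupp.mem_support_iff]
    intro h
    exact hj (by rw [h, map_zero])
  map_add' f g := by ext j; simp
  map_smul' r f := by ext j; simp

@[simp]
theorem pointwise_apply {W : Type*} [AddCommGroup W] [Module ℝ W] (φ : ℕ → W →ₗ[ℝ] W) (f : ℕ →₀ W)
    (j : ℕ) : pointwise φ f j = φ j (f j) := rfl

namespace GelfandDatum

variable (D : GelfandDatum.{u})

/-- The space of the Harish-Chandra module of a Gelfand datum: the sum of `N0` and of copies of `W`,
the `j`-th of which has `K`-type `2 (j + 1)`. -/
def Ind : Type u := D.N0 × (ℕ →₀ D.W)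

instance : AddCommGroup D.Ind := inferInstanceAs (AddCommGroup (D.N0 × (ℕ →₀ D.W)))

instance : Module ℝ D.Ind := inferInstanceAs (Module ℝ (D.N0 × (ℕ →₀ D.W)))

namespace Ind

variable {D}

theorem ext {v w : D.Ind} (h1 : v.1 = w.1) (h2 : ∀ j, v.2 j = w.2 j) : v = w :=
  Prod.ext h1 (Finsupp.ext h2)

@[simp] theorem add_fst (v w : D.Ind) : (v + w).1 = v.1 + w.1 := rfl
@[simp] theorem add_snd (v w : D.Ind) : (v + w).2 = v.2 + w.2 := rfl
@[simp] theorem sub_fst (v w : D.Ind) : (v - w).1 = v.1 - w.1 := rfl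
@[simp] theorem sub_snd (v w : D.Ind) : (v - w).2 = v.2 - w.2 := rfl
@[simp] theorem neg_fst (v : D.Ind) : (-v).1 = -v.1 := rfl
@[simp] theorem neg_snd (v : D.Ind) : (-v).2 = -v.2 := rfl
@[simp] theorem smul_fst (r : ℝ) (v : D.Ind) : (r • v).1 = r • v.1 := rfl
@[simp] theorem smul_snd (r : ℝ) (v : D.Ind) : (r • v).2 = r • v.2 := rfl
@[simp] theorem zero_fst : (0 : D.Ind).1 = 0 := rfl
@[simp] theorem zero_snd : (0 : D.Ind).2 = 0 := rfl

/-- The linear map to `D.Ind` with given components. -/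
def pair {V : Type*} [AddCommGroup V] [Module ℝ V] (f : V →ₗ[ℝ] D.N0) (g : V →ₗ[ℝ] (ℕ →₀ D.W)) :
    V →ₗ[ℝ] D.Ind :=
  LinearMap.prod f g

variable (D)

/-- The component of `K`-type `0`. -/
def fst : D.Ind →ₗ[ℝ] D.N0 := LinearMap.fst ℝ D.N0 (ℕ →₀ D.W)

/-- The components of positive `K`-type. -/
def snd : D.Ind →ₗ[ℝ] (ℕ →₀ D.W) := LinearMap.snd ℝ D.N0 (ℕ →₀ D.W)

variable {D} in
@[simp] theorem fst_apply (v : D.Ind) : fst D v = v.1 := rfl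

variable {D} in
@[simp] theorem snd_apply (v : D.Ind) : snd D v = v.2 := rfl

/-- The raising operator. -/
def raise : D.Ind →ₗ[ℝ] (ℕ →₀ D.W) :=
  Finsupp.lsingle 0 ∘ₗ D.P ∘ₗ fst D + Finsupp.lmapDomain D.W ℝ Nat.succ ∘ₗ snd D

/-- The lowering operator on the components of positive `K`-type. -/
def lower : (ℕ →₀ D.W) →ₗ[ℝ] (ℕ →₀ D.W) :=
  pointwise (fun j => (1 / 2 : ℝ) • D.T - ((j + 1) * (j + 2) : ℝ) • LinearMap.id) ∘ₗ
    Finsupp.lcomapDomain Nat.succ Nat.succ_injective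

variable {D}

@[simp]
theorem raise_zero (v : D.Ind) : raise D v 0 = D.P v.1 := by
  have h : Finsupp.mapDomain Nat.succ v.2 0 = 0 :=
    Finsupp.mapDomain_of_notMem_range _ _ (by simp)
  simp [raise, h]

@[simp]
theorem raise_succ (v : D.Ind) (j : ℕ) : raise D v (j + 1) = v.2 j := by
  have h : Finsupp.mapDomain Nat.succ v.2 (Nat.succ j) = v.2 j :=
    Finsupp.mapDomain_apply Nat.succ_injective _ _
  simpa [raise] using h

@[simp]
theorem lower_apply (f : ℕ →₀ D.W) (j : ℕ) : lower D f j =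
    (1 / 2 : ℝ) • D.T (f (j + 1)) - ((j + 1) * (j + 2) : ℝ) • f (j + 1) := rfl

variable (D)

/-- The action of `h`. -/
def opH : Module.End ℝ D.Ind :=
  pair (D.Q ∘ₗ Finsupp.lapply 0 ∘ₗ snd D)
    (raise D + lower D ∘ₗ snd D)

/-- The action of `x + y`. -/
def opS : Module.End ℝ D.Ind :=
  pair (D.Q ∘ₗ D.J ∘ₗ Finsupp.lapply 0 ∘ₗ snd D)
    (pointwise (fun _ => D.J) ∘ₗ (lower D ∘ₗ snd D - raise D))

/-- The action of `x - y`. -/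
def opU : Module.End ℝ D.Ind :=
  pair 0
    (pointwise (fun j => (2 * (j + 1) : ℝ) • D.J) ∘ₗ snd D)

variable {D}

@[simp] theorem opH_fst (v : D.Ind) : (opH D v).1 = D.Q (v.2 0) := rfl

@[simp]
theorem opH_snd (v : D.Ind) (j : ℕ) : (opH D v).2 j = raise D v j + lower D v.2 j := rfl

@[simp] theorem opS_fst (v : D.Ind) : (opS D v).1 = D.Q (D.J (v.2 0)) := rfl

@[simp]
theorem opS_snd (v : D.Ind) (j : ℕ) :
    (opS D v).2 j = D.J (lower D v.2 j - raise D v j) := rfl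

@[simp] theorem opU_fst (v : D.Ind) : (opU D v).1 = 0 := rfl

@[simp]
theorem opU_snd (v : D.Ind) (j : ℕ) : (opU D v).2 j = (2 * (j + 1) : ℝ) • D.J (v.2 j) := rfl

/-- With R raising and L lowering, the bracket in slot j ≥ 1 is 2J(RL - LR). The T/2 terms cancel,
and (j+1)(j+2) - j(j+1) = 2(j+1) gives 2u. In slot 0 the passage through N0 contributes JPQ + PQJ =
JT, which fits the same pattern; on N0 the bracket vanishes because QJP = 0. -/
theorem opH_opS (v : D.Ind) : opH D (opS D v) - opS D (opH D v) = (2 : ℝ) • opU D v := by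
  refine ext ?_ fun j => ?_
  · simp
  · rcases j with _ | j
    · simp [-one_div, T_J]
      simp only [T_apply, map_sub, J_J]
      module
    · simp [-one_div, T_J]
      module

theorem opU_opH (v : D.Ind) : opU D (opH D v) - opH D (opU D v) = (-2 : ℝ) • opS D v := by
  refine ext ?_ fun j => ?_
  · simp
  · rcases j with _ | j
    · simp [-one_div, T_J]
      module
    · simp [-one_div, T_J]
      module

theorem opU_opS (v : D.Ind) : opU D (opS D v) - opS D (opU D v) = (2 : ℝ) • opH D v := by
  refine ext ?_ fun j => ?_
  · simp
  · rcases j with _ | j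
    · simp [-one_div, T_J]
      module
    · simp [-one_div, T_J]
      module

variable (D)

/-- The action of `𝔤`. -/
def lieHom : 𝔤 →ₗ⁅ℝ⁆ Module.End ℝ D.Ind where
  toFun z := z.1 0 0 • opH D + ((z.1 0 1 + z.1 1 0) / 2) • opS D +
    ((z.1 0 1 - z.1 1 0) / 2) • opU D
  map_add' a b := by
    simp only [AddMemClass.coe_add, Matrix.add_apply]
    module
  map_smul' r a := by
    simp only [SetLike.val_smul, Matrix.smul_apply, smul_eq_mul, RingHom.id_apply]
    module
  map_lie' {a b} := by
    have ha := trace_g a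
    have hb := trace_g b
    -- These three relations bring every product to the order `opS`, `opH`, `opU`; the bracket
    -- identity is then linear in the remaining monomials.
    have h1 : opH D * opS D = opS D * opH D + (2 : ℝ) • opU D :=
      LinearMap.ext fun v => sub_eq_iff_eq_add'.1 (opH_opS v)
    have h2 : opU D * opH D = opH D * opU D - (2 : ℝ) • opS D :=
      LinearMap.ext fun v => by
        have := opU_opH v
        rw [sub_eq_iff_eq_add'] at this
        simpa [sub_eq_add_neg] using this
    have h3 : opU D * opS D = opS D * opU D + (2 : ℝ) • opH D :=
      LinearMap.ext fun v => sub_eq_iff_eq_add'.1 (opU_opS v)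
    rw [LieRing.of_associative_ring_bracket, LieSubalgebra.coe_bracket,
      LieRing.of_associative_ring_bracket]
    simp only [Matrix.sub_apply, Matrix.mul_apply, Fin.sum_univ_two, ha, hb]
    simp only [add_mul, mul_add, smul_mul_assoc, mul_smul_comm, h1, h2, h3]
    module

instance : Module U𝔤 D.Ind :=
  Module.compHom D.Ind (UniversalEnvelopingAlgebra.lift ℝ (lieHom D)).toRingHom

theorem U_smul_def (a : U𝔤) (v : D.Ind) :
    a • v = UniversalEnvelopingAlgebra.lift ℝ (lieHom D) a v := rfl

instance : IsScalarTower ℝ U𝔤 D.Ind where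
  smul_assoc r a v := by rw [U_smul_def, U_smul_def, map_smul]; rfl

theorem ι_smul (z : 𝔤) (v : D.Ind) : ι𝔤 z • v = lieHom D z v := by
  rw [U_smul_def, UniversalEnvelopingAlgebra.lift_ι_apply]

@[simp]
theorem h_smul (v : D.Ind) : ι𝔤 hElt • v = opH D v := by
  rw [ι_smul]; simp [lieHom, coe_hElt]

@[simp]
theorem s_smul (v : D.Ind) : ι𝔤 sElt • v = opS D v := by
  rw [ι_smul]; simp [lieHom, coe_sElt]

@[simp]
theorem u_smul (v : D.Ind) : ι𝔤 uElt • v = opU D v := by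
  rw [ι_smul]; simp [lieHom, coe_uElt]

/-- The action of `K`. -/
def rep : Representation ℝ K D.Ind where
  toFun k := pair (fst D)
    (pointwise (fun j => D.cx (chi k ^ (2 * (j + 1)))) ∘ₗ snd D)
  map_one' := LinearMap.ext fun v => ext rfl fun j => by
    change D.cx (chi 1 ^ (2 * (j + 1))) (v.2 j) = v.2 j
    simp
  map_mul' k l := LinearMap.ext fun v => ext rfl fun j => by
    change D.cx (chi (k * l) ^ (2 * (j + 1))) (v.2 j) =
      D.cx (chi k ^ (2 * (j + 1))) (D.cx (chi l ^ (2 * (j + 1))) (v.2 j))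
    rw [map_mul, mul_pow, cx_mul]

variable {D}

@[simp] theorem rep_fst (k : K) (v : D.Ind) : (rep D k v).1 = v.1 := rfl

@[simp]
theorem rep_snd (k : K) (v : D.Ind) (j : ℕ) :
    (rep D k v).2 j = D.cx (chi k ^ (2 * (j + 1))) (v.2 j) := rfl

end Ind

end GelfandDatum

/-! ## A criterion for admissibility -/

/-- The coordinate of a `K`-type with values in the complex numbers, on which `k ∈ K` acts by
`chi k ^ n`. -/
def kTypeCoord : (n : ℕ) → KType n →ₗ[ℝ] ℂ
  | 0 => Complex.ofRealAm.toLinearMap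
  | _ + 1 =>
    { toFun := fun v : Fin 2 → ℝ => ⟨v 0, -v 1⟩
      map_add' := fun v w : Fin 2 → ℝ => Complex.ext rfl (neg_add (v 1) (w 1))
      map_smul' := fun r (v : Fin 2 → ℝ) => by
        rw [Complex.real_smul]
        exact Complex.ext (by simp; rfl) (by simp; rfl) }

theorem kTypeCoord_injective (n : ℕ) : Function.Injective (kTypeCoord n) := by
  rcases n with _ | n
  · exact Complex.ofReal_injective
  · intro (v : Fin 2 → ℝ) (w : Fin 2 → ℝ) h
    have h0 : v 0 = w 0 := congrArg Complex.re h
    have h1 : -v 1 = -w 1 := congrArg Complex.im h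
    exact funext fun i => by
      fin_cases i
      · exact h0
      · exact neg_injective h1

/-- The coordinate is v₀ - i v₁ because `chi` reads off the upper row of a rotation matrix [[a, b],
[-b, a]]. -/
theorem kTypeCoord_rep (n : ℕ) (k : K) (v : KType n) :
    kTypeCoord n (kTypeRep n k v) = chi k ^ n * kTypeCoord n v := by
  rcases n with _ | n
  · simp only [pow_zero, one_mul]; rfl
  · have h1 : kTypeRep (n + 1) k v =
      Matrix.mulVec ((k ^ (n + 1) : K) : Matrix (Fin 2) (Fin 2) ℝ) v := rfl
    rw [h1, coe_eq_chi, map_pow]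
    apply Complex.ext
    · change Matrix.mulVec _ (v : Fin 2 → ℝ) 0 =
        (chi k ^ (n + 1) * (⟨(v : Fin 2 → ℝ) 0, -(v : Fin 2 → ℝ) 1⟩ : ℂ)).re
      simp [Matrix.mulVec, dotProduct, Fin.sum_univ_two]
    · change -Matrix.mulVec _ (v : Fin 2 → ℝ) 1 =
        (chi k ^ (n + 1) * (⟨(v : Fin 2 → ℝ) 0, -(v : Fin 2 → ℝ) 1⟩ : ℂ)).im
      simp [Matrix.mulVec, dotProduct, Fin.sum_univ_two]

instance (n : ℕ) : FiniteDimensional ℝ (KType n) :=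
  FiniteDimensional.of_injective (kTypeCoord n) (kTypeCoord_injective n)

/-- J turns V into a finite-dimensional complex vector space; a complex basis splits it into copies
of ℂ, each identified with V_{n+1}. -/
theorem exists_equiv_of_complexStructure {V : Type*} [AddCommGroup V] [Module ℝ V]
    [FiniteDimensional ℝ V] (n : ℕ) (J : V →ₗ[ℝ] V) (hJ : ∀ v, J (J v) = -v) :
    ∃ (m : ℕ) (e : V ≃ₗ[ℝ] (Fin m → KType (n + 1))), ∀ (v : V) (j : Fin m),
      kTypeCoord (n + 1) (e (J v) j) = Complex.I * kTypeCoord (n + 1) (e v j) := by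
  let c : ℂ →ₐ[ℝ] Module.End ℝ V := Complex.liftAux J (LinearMap.ext fun w => by simp [hJ])
  let _ : Module ℂ V := Module.compHom V c.toRingHom
  have hc (z : ℂ) (v : V) : z • v = c z v := rfl
  have : IsScalarTower ℝ ℂ V := ⟨fun r z v => by rw [hc, hc, map_smul]; rfl⟩
  have : FiniteDimensional ℂ V := Module.Finite.of_restrictScalars_finite ℝ ℂ V
  let f : ℂ ≃ₗ[ℝ] KType (n + 1) := LinearEquiv.symm <|
    LinearEquiv.ofBijective (kTypeCoord (n + 1)) ⟨kTypeCoord_injective _, fun z =>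
      ⟨(![z.re, -z.im] : Fin 2 → ℝ), Complex.ext rfl (neg_neg z.im)⟩⟩
  have hf (z : ℂ) : kTypeCoord (n + 1) (f z) = z :=
    LinearEquiv.apply_symm_apply (LinearEquiv.ofBijective (kTypeCoord (n + 1)) _) z
  refine ⟨_, ((Module.finBasis ℂ V).equivFun.restrictScalars ℝ).trans
    (LinearEquiv.piCongrRight fun _ => f), fun v j => ?_⟩
  have h : J v = Complex.I • v := by rw [hc]; simp [c]
  simp [hf, h]

/-! ### Isotypic components of a representation of K -/

section

variable {M : Type u} [AddCommGroup M] [Module ℝ M]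

/-- The subspace on which `U ^ 2 = - n ^ 2`. -/
def isotypic (U : Module.End ℝ M) (n : ℕ) : Submodule ℝ M :=
  Module.End.eigenspace (U * U) (-(n : ℝ) ^ 2)

theorem mem_isotypic {U : Module.End ℝ M} {n : ℕ} {v : M} :
    v ∈ isotypic U n ↔ U (U v) = -(n : ℝ) ^ 2 • v := by
  rw [isotypic, Module.End.mem_eigenspace_iff]; rfl

theorem isotypic_independent (U : Module.End ℝ M) : iSupIndep (isotypic U) := by
  refine (Module.End.eigenspaces_iSupIndep (U * U)).comp fun n m h => ?_
  have : (n : ℝ) ^ 2 = (m : ℝ) ^ 2 := neg_injective h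
  exact_mod_cast (pow_left_inj₀ (by positivity) (by positivity) two_ne_zero).1 this

theorem map_mem_isotypic {U : Module.End ℝ M} {n : ℕ} {v : M} (hv : v ∈ isotypic U n) :
    U v ∈ isotypic U n := by
  rw [mem_isotypic] at hv ⊢
  rw [hv, map_smul]

/-- The infinitesimal generator `U` determines the action of `K` by the usual formula. -/
def IsGenerator (ρ : Representation ℝ K M) (U : Module.End ℝ M) : Prop :=
  ∀ (n : ℕ), ∀ v ∈ isotypic U n, ∀ k : K,
    ρ k v = (chi k ^ n).re • v + ((chi k ^ n).im / n) • U v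

/-- K acts trivially on the component n = 0, so any basis splits it. For n > 0 the operator U/n is a
complex structure, through which k acts as chi(k)^n, and a complex basis gives copies of V_n. -/
theorem isAdmissible_of_isotypic {ρ : Representation ℝ K M} (U : Module.End ℝ M)
    (hρ : IsGenerator ρ U) (htop : iSup (isotypic U) = ⊤)
    (hfin : ∀ n, FiniteDimensional ℝ (isotypic U n)) : IsAdmissible ρ := by
  have key : ∀ n, ∃ (m : ℕ) (e : isotypic U n ≃ₗ[ℝ] (Fin m → KType n)),
      ∀ (k : K) (v w : isotypic U n) (j : Fin m), ρ k (v : M) = w →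
        e w j = kTypeRep n k (e v j) := by
    intro n
    have := hfin n
    rcases n with _ | n
    · refine ⟨_, (Module.finBasis ℝ (isotypic U 0)).equivFun, fun k v w j h => ?_⟩
      have hv := hρ 0 v v.2 k
      rw [h] at hv
      have : w = v := Subtype.ext (by simpa using hv)
      rw [this]; rfl
    · have hn : ((n : ℝ) + 1) ≠ 0 := by positivity
      let J : isotypic U (n + 1) →ₗ[ℝ] isotypic U (n + 1) :=
        ((n : ℝ) + 1)⁻¹ • U.restrict (fun v hv => map_mem_isotypic hv)
      have hJc (v : isotypic U (n + 1)) : (J v : M) = ((n : ℝ) + 1)⁻¹ • U v := rfl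
      obtain ⟨m, e, he⟩ := exists_equiv_of_complexStructure n J (fun v => Subtype.ext <| by
        have h := mem_isotypic.1 v.2
        rw [hJc, hJc, map_smul, h, smul_smul, smul_smul, Submodule.coe_neg, ← neg_one_smul ℝ (v : M)]
        congr 1
        push_cast
        field_simp)
      refine ⟨m, e, fun k v w j h => kTypeCoord_injective _ ?_⟩
      have hw : w = (chi k ^ (n + 1)).re • v + (chi k ^ (n + 1)).im • J v := Subtype.ext <| by
        rw [← h, hρ (n + 1) v v.2 k, Submodule.coe_add, Submodule.coe_smul, Submodule.coe_smul,
          hJc, smul_smul, div_eq_mul_inv, Nat.cast_add_one]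
      rw [kTypeCoord_rep, hw, map_add, map_smul, map_smul, Pi.add_apply, Pi.smul_apply,
        Pi.smul_apply, map_add, map_smul, map_smul, he, Complex.real_smul, Complex.real_smul]
      conv_rhs => rw [← Complex.re_add_im (chi k ^ (n + 1))]
      ring
  choose m e he using key
  have hint : DirectSum.IsInternal (isotypic U) :=
    DirectSum.isInternal_submodule_of_iSupIndep_of_iSup_eq_top (isotypic_independent U) htop
  let E : (⨁ n, isotypic U n) ≃ₗ[ℝ] M := LinearEquiv.ofBijective (DirectSum.coeLinearMap _) hint
  let F : (⨁ n, isotypic U n) ≃ₗ[ℝ] ⨁ n : ℕ, (Fin (m n) → KType n) :=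
    DFinsupp.mapRange.linearEquiv e
  refine ⟨m, E.symm.trans F, fun k v n j => ?_⟩
  obtain ⟨x, rfl⟩ := E.surjective v
  simp only [LinearEquiv.trans_apply, LinearEquiv.symm_apply_apply]
  induction x using DirectSum.induction_on with
  | zero => simp
  | add x y hx hy => simp only [map_add, DirectSum.add_apply, Pi.add_apply, hx, hy]
  | of i v =>
    have hE (v : isotypic U i) : E (DirectSum.of (fun n => isotypic U n) i v) = v :=
      DirectSum.coeLinearMap_of _ i v
    have hmem : ρ k (v : M) ∈ isotypic U i := by
      rw [hρ i v v.2 k]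
      exact add_mem (Submodule.smul_mem _ _ v.2) (Submodule.smul_mem _ _ (map_mem_isotypic v.2))
    have h1 : ρ k (E (DirectSum.of (fun n => isotypic U n) i v)) =
        E (DirectSum.of (fun n => isotypic U n) i ⟨_, hmem⟩) := by rw [hE, hE]
    rw [h1, LinearEquiv.symm_apply_apply]
    have hF (w : isotypic U i) : F (DirectSum.of (fun n => isotypic U n) i w) =
      DirectSum.of (fun n => (Fin (m n) → KType n)) i (e i w) := 
        DFinsupp.mapRange_single (hf := fun i => map_zero (e i))
    rw [hF, hF]
    by_cases hi : i = n
    · subst hi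
      rw [DirectSum.of_eq_same, DirectSum.of_eq_same]
      exact he i k v _ j rfl
    · rw [DirectSum.of_eq_of_ne _ _ _ (Ne.symm hi), DirectSum.of_eq_of_ne _ _ _ (Ne.symm hi)]
      simp

theorem hasDerivAt_chi_pow (n : ℕ) (c : ℂ) :
    HasDerivAt (fun t : ℝ => chi (expK uElt uElt_skew t) ^ n * c) (n * Complex.I * c) 0 := by
  have h1 : (fun t : ℝ => chi (expK uElt uElt_skew t) ^ n * c) =
      fun t : ℝ => Complex.exp (t * (n * Complex.I)) * c := by
    funext t
    rw [chi_expK, ← Complex.exp_nat_mul]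
    congr 2
    simp [coe_uElt]
    ring
  rw [h1]
  have h2 : HasDerivAt (fun z : ℂ => Complex.exp (z * (n * Complex.I)) * c)
      (n * Complex.I * c) ((0 : ℝ) : ℂ) := by
    have h3 := (((hasDerivAt_id ((0 : ℝ) : ℂ)).mul_const (n * Complex.I)).cexp).mul_const c
    simpa using h3
  exact h2.comp_ofReal

/-- In the complex coordinates `F n j` the group acts by chi^n, so differentiation shows that U acts
by multiplication by ni. A vector is thus in the n-th component exactly when its coordinates of
other K-types vanish, and all three claims can be read off. -/
theorem isotypic_of_isAdmissible {ρ : Representation ℝ K M} (hadm : IsAdmissible ρ)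
    (U : Module.End ℝ M) (hU : ∀ (v : M) (φ : Module.Dual ℝ M),
      HasDerivAt (fun t : ℝ => φ (ρ (expK uElt uElt_skew t) v)) (φ (U v)) 0) :
    IsGenerator ρ U ∧ iSup (isotypic U) = ⊤ ∧ ∀ n, FiniteDimensional ℝ (isotypic U n) := by
  obtain ⟨m, e, he⟩ := hadm
  let F (n : ℕ) (j : Fin (m n)) : M →ₗ[ℝ] ℂ := kTypeCoord n ∘ₗ LinearMap.proj j ∘ₗ
    DirectSum.component ℝ ℕ (fun n => Fin (m n) → KType n) n ∘ₗ e.toLinearMap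
  have F_apply (n : ℕ) (j : Fin (m n)) (v : M) : F n j v = kTypeCoord n (e v n j) := rfl
  have F_rep (n : ℕ) (j : Fin (m n)) (k : K) (v : M) : F n j (ρ k v) = chi k ^ n * F n j v := by
    rw [F_apply, he, kTypeCoord_rep, F_apply]
  have F_inj {v w : M} (h : ∀ n j, F n j v = F n j w) : v = w :=
    e.injective <| DFinsupp.ext fun n => funext fun j => kTypeCoord_injective n (h n j)
  have F_U (n : ℕ) (j : Fin (m n)) (v : M) : F n j (U v) = n * Complex.I * F n j v := by
    have h1 := hasDerivAt_chi_pow n (F n j v)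
    simp_rw [← F_rep] at h1
    -- The hypothesis concerns real functionals, so the real and imaginary parts are compared
    -- separately, by uniqueness of derivatives.
    apply Complex.ext
    · exact (hU v (Complex.reLm ∘ₗ F n j)).unique
        (Complex.reCLM.hasFDerivAt.comp_hasDerivAt (0 : ℝ) h1)
    · exact (hU v (Complex.imLm ∘ₗ F n j)).unique
        (Complex.imCLM.hasFDerivAt.comp_hasDerivAt (0 : ℝ) h1)
  have mem_iff (n : ℕ) (v : M) : v ∈ isotypic U n ↔ ∀ i j, i ≠ n → F i j v = 0 := by
    rw [mem_isotypic]
    constructor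
    · intro h i j hi
      have h1 := congrArg (F i j) h
      rw [F_U, F_U, map_smul, Complex.real_smul] at h1
      have h2 : ((i : ℂ) ^ 2 - (n : ℂ) ^ 2) * F i j v = 0 := by
        push_cast at h1
        linear_combination -h1 + (i : ℂ) ^ 2 * F i j v * Complex.I_sq
      refine (mul_eq_zero.1 h2).resolve_left fun h3 => hi ?_
      have h4 : i ^ 2 = n ^ 2 := by exact_mod_cast sub_eq_zero.1 h3
      exact Nat.pow_left_injective two_ne_zero h4
    · intro h
      refine F_inj fun i j => ?_
      rw [F_U, F_U, map_smul, Complex.real_smul]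
      by_cases hi : i = n
      · subst hi
        push_cast
        linear_combination (i : ℂ) ^ 2 * F i j v * Complex.I_sq
      · rw [h i j hi]; simp
  refine ⟨fun n v hv k => F_inj fun i j => ?_, ?_, fun n => ?_⟩
  · rw [F_rep, map_add, map_smul, map_smul, F_U, Complex.real_smul, Complex.real_smul]
    by_cases hi : i = n
    · subst hi
      -- For i = 0 the quotient by i is 0 by convention, and its numerator, the imaginary part of 1,
      -- vanishes as well.
      rcases eq_or_ne i 0 with rfl | h0
      · simp
      · have h0 : (i : ℂ) ≠ 0 := by exact_mod_cast h0
        nth_rw 1 [← Complex.re_add_im (chi k ^ i)]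
        push_cast
        field_simp
    · rw [(mem_iff n v).1 hv i j hi]; simp
  · rw [eq_top_iff]
    intro v _
    obtain ⟨x, rfl⟩ := e.symm.surjective v
    induction x using DirectSum.induction_on with
    | zero => simp
    | add x y hx hy => rw [map_add]; exact add_mem (hx trivial) (hy trivial)
    | of n y =>
      refine Submodule.mem_iSup_of_mem n ((mem_iff _ _).2 fun i j hi => ?_)
      rw [F_apply, LinearEquiv.apply_symm_apply, DirectSum.of_eq_of_ne _ _ _ hi]
      simp
  · let f : isotypic U n →ₗ[ℝ] (Fin (m n) → KType n) :=
      DirectSum.component ℝ ℕ (fun n => Fin (m n) → KType n) n ∘ₗ e.toLinearMap ∘ₗ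
        (isotypic U n).subtype
    refine FiniteDimensional.of_injective f fun v w h => Subtype.ext <| F_inj fun i j => ?_
    by_cases hi : i = n
    · subst hi
      exact congrArg (kTypeCoord i) (congrFun h j)
    · rw [(mem_iff n v).1 v.2 i j hi, (mem_iff n w).1 w.2 i j hi]

end

/-! ### The axioms of a Harish-Chandra module for `Ind` -/

namespace GelfandDatum

variable (D : GelfandDatum.{u})

namespace Ind

/-- The inclusion of the component of `K`-type `0`. -/
def inN : D.N0 →ₗ[ℝ] D.Ind := LinearMap.inl ℝ D.N0 (ℕ →₀ D.W)

/-- The inclusion of the components of positive `K`-type. -/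
def inS : (ℕ →₀ D.W) →ₗ[ℝ] D.Ind := LinearMap.inr ℝ D.N0 (ℕ →₀ D.W)

/-- The inclusion of the component of `K`-type `2 (j + 1)`. -/
def inW (j : ℕ) : D.W →ₗ[ℝ] D.Ind := inS D ∘ₗ Finsupp.lsingle j

variable {D}

@[simp] theorem inN_fst (n : D.N0) : (inN D n).1 = n := rfl
@[simp] theorem inN_snd (n : D.N0) : (inN D n).2 = 0 := rfl
@[simp] theorem inW_fst (j : ℕ) (w : D.W) : (inW D j w).1 = 0 := rfl
@[simp] theorem inW_snd (j : ℕ) (w : D.W) : (inW D j w).2 = Finsupp.single j w := rfl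

theorem induction {p : D.Ind → Prop} (hN : ∀ n, p (inN D n)) (hW : ∀ j w, p (inW D j w))
    (hadd : ∀ v w, p v → p w → p (v + w)) (v : D.Ind) : p v := by
  have h (f : ℕ →₀ D.W) : p (inS D f) := by
    induction f using Finsupp.induction_linear with
    | zero => exact hN 0
    | add f g hf hg => rw [map_add]; exact hadd _ _ hf hg
    | single j w => exact hW j w
  have h2 := hadd _ _ (hN v.1) (h v.2)
  rwa [show inN D v.1 + inS D v.2 = v from ext (add_zero _) fun j => zero_add _] at h2

theorem opU_inN (n : D.N0) : opU D (inN D n) = 0 := ext rfl fun j => by simp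

theorem opU_inW (j : ℕ) (w : D.W) : opU D (inW D j w) = (2 * (j + 1) : ℝ) • inW D j (D.J w) := by
  refine ext (by simp) fun i => ?_
  by_cases h : j = i
  · subst h; simp
  · simp [Finsupp.single_eq_of_ne' h]

theorem rep_inN (k : K) (n : D.N0) : rep D k (inN D n) = inN D n := ext rfl fun j => by simp

theorem rep_inW (k : K) (j : ℕ) (w : D.W) :
    rep D k (inW D j w) = inW D j (D.cx (chi k ^ (2 * (j + 1))) w) := by
  refine ext rfl fun i => ?_
  by_cases h : j = i
  · subst h; simp
  · simp [Finsupp.single_eq_of_ne' h]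

theorem opH_inN (n : D.N0) : opH D (inN D n) = inW D 0 (D.P n) := by
  refine ext (by simp) fun i => ?_
  rcases i with _ | i <;> simp

theorem opH_inW_zero (w : D.W) : opH D (inW D 0 w) = inN D (D.Q w) + inW D 1 w := by
  refine ext (by simp) fun i => ?_
  rcases i with _ | _ | i <;> simp

theorem opH_inW_succ (j : ℕ) (w : D.W) : opH D (inW D (j + 1) w) =
    inW D j ((1 / 2 : ℝ) • D.T w - ((j + 1) * (j + 2) : ℝ) • w) + inW D (j + 2) w := by
  refine ext (by simp) fun i => ?_
  rw [opH_snd, lower_apply, add_snd, Finsupp.add_apply, inW_snd, inW_snd, inW_snd]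
  have h1 : raise D (inW D (j + 1) w) i = Finsupp.single (j + 2) w i := by
    rcases i with _ | i
    · simp
    · rw [raise_succ, inW_snd]
      simp [Finsupp.single_apply]
  rw [h1, add_comm]
  congr 1
  by_cases h : j = i
  · subst h; simp
  · simp [h]

/-- On each slot the orbit is a circle cos(at)w + sin(at)Jw, where a is the K-type times the
coefficient of z along u. -/
theorem hasDerivAt_rep (z : 𝔤)
    (hz : (z : Matrix (Fin 2) (Fin 2) ℝ)ᵀ = -(z : Matrix (Fin 2) (Fin 2) ℝ))
    (v : D.Ind) (φ : Module.Dual ℝ D.Ind) :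
    HasDerivAt (fun t : ℝ => φ (rep D (expK z hz t) v)) (φ (ι𝔤 z • v)) 0 := by
  have hu (v : D.Ind) : ι𝔤 z • v = z.1 0 1 • opU D v := by
    conv_lhs => rw [eq_smul_uElt z hz]
    rw [map_smul, smul_assoc, u_smul]
  rw [hu]
  induction v using induction with
  | hN n =>
    simp_rw [rep_inN, opU_inN, smul_zero, map_zero]
    exact hasDerivAt_const _ _
  | hW j w =>
    have h1 (t : ℝ) : chi (expK z hz t) ^ (2 * (j + 1)) =
        Complex.exp ((2 * (j + 1) * z.1 0 1 * t : ℝ) * Complex.I) := by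
      rw [chi_expK, ← Complex.exp_nat_mul]
      congr 1
      push_cast
      ring
    simp_rw [rep_inW, h1, cx_apply, Complex.exp_ofReal_mul_I_re, Complex.exp_ofReal_mul_I_im,
      map_add, map_smul, opU_inW, map_smul, smul_eq_mul]
    have h2 : HasDerivAt (fun t : ℝ => 2 * (j + 1) * z.1 0 1 * t) (2 * (j + 1) * z.1 0 1) 0 := by
      simpa using (hasDerivAt_id (0 : ℝ)).const_mul (2 * (j + 1) * z.1 0 1)
    refine ((h2.cos.mul_const (φ (inW D j w))).add
      (h2.sin.mul_const (φ (inW D j (D.J w))))).congr_deriv ?_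
    simp
    ring
  | hadd v w hv hw =>
    simp_rw [map_add, smul_add, map_add]
    exact hv.add hw

theorem raise_rep (k : K) (v : D.Ind) (j : ℕ) :
    raise D (rep D k v) j = D.cx (chi k ^ (2 * j)) (raise D v j) := by
  rcases j with _ | j <;> simp

theorem J_cx (z : ℂ) (w : D.W) : D.J (D.cx z w) = D.cx z (D.J w) := by
  simp [cx_apply]

theorem T_cx (z : ℂ) (w : D.W) : D.T (D.cx z w) = D.cx z (D.T w) := by
  simp [cx_apply, T_J]

theorem lower_rep (k : K) (v : D.Ind) (j : ℕ) :
    lower D (rep D k v).2 j = D.cx (chi k ^ (2 * (j + 2))) (lower D v.2 j) := by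
  simp only [lower_apply, rep_snd, T_cx, map_sub, map_smul]

theorem chi_pow_mul_inv_pow (k : K) (m n : ℕ) : chi k ^ (n + m) * chi k⁻¹ ^ n = chi k ^ m := by
  rw [chi_inv, pow_add, mul_right_comm, ← mul_pow, chi_mul_conj, one_pow, one_mul]

theorem chi_pow_mul_inv_pow' (k : K) (m n : ℕ) :
    chi k ^ n * chi k⁻¹ ^ (n + m) = chi k⁻¹ ^ m := by
  rw [chi_inv, pow_add, ← mul_assoc, ← mul_pow, chi_mul_conj, one_pow, one_mul]

/-- Conjugation by k multiplies the raising part of h by chi(k)² and the lowering part by its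
inverse. Since s is made of the same parts, multiplied by -J and J, the real and imaginary parts of
chi(k)² reassemble to a combination of h and s. -/
theorem rep_opH_rep_inv (k : K) (v : D.Ind) : rep D k (opH D (rep D k⁻¹ v)) =
    ((chi k) ^ 2).re • opH D v - ((chi k) ^ 2).im • opS D v := by
  have hre : (chi k⁻¹ ^ 2).re = (chi k ^ 2).re := by rw [chi_inv, ← map_pow, Complex.conj_re]
  have him : (chi k⁻¹ ^ 2).im = -(chi k ^ 2).im := by rw [chi_inv, ← map_pow, Complex.conj_im]
  refine ext ?_ fun j => ?_
  · simp only [rep_fst, opH_fst, opS_fst, rep_snd, cx_apply, zero_add, mul_one, hre, him, sub_fst,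
      smul_fst, map_sub, map_smul, neg_smul, ← sub_eq_add_neg]
  · rw [rep_snd, opH_snd, raise_rep, lower_rep, map_add, ← cx_mul, ← cx_mul,
      show 2 * (j + 1) = 2 * j + 2 by ring, chi_pow_mul_inv_pow,
      show 2 * (j + 2) = 2 * j + 2 + 2 by ring, chi_pow_mul_inv_pow', cx_apply, cx_apply, hre, him]
    simp only [sub_snd, smul_snd, Finsupp.sub_apply, Finsupp.smul_apply, opH_snd, opS_snd, map_sub]
    module

theorem rep_opS_rep_inv (k : K) (v : D.Ind) : rep D k (opS D (rep D k⁻¹ v)) =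
    ((chi k) ^ 2).im • opH D v + ((chi k) ^ 2).re • opS D v := by
  have hre : (chi k⁻¹ ^ 2).re = (chi k ^ 2).re := by rw [chi_inv, ← map_pow, Complex.conj_re]
  have him : (chi k⁻¹ ^ 2).im = -(chi k ^ 2).im := by rw [chi_inv, ← map_pow, Complex.conj_im]
  refine ext ?_ fun j => ?_
  · simp only [rep_fst, opH_fst, opS_fst, rep_snd, cx_apply, zero_add, mul_one, hre, him, add_fst,
      smul_fst, map_add, map_smul, neg_smul, map_neg, J_J, smul_neg, neg_neg, add_comm]
  · rw [rep_snd, opS_snd, raise_rep, lower_rep, ← J_cx, map_sub, ← cx_mul, ← cx_mul,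
      show 2 * (j + 1) = 2 * j + 2 by ring, chi_pow_mul_inv_pow,
      show 2 * (j + 2) = 2 * j + 2 + 2 by ring, chi_pow_mul_inv_pow', cx_apply, cx_apply, hre, him]
    simp only [add_snd, smul_snd, Finsupp.add_apply, Finsupp.smul_apply, opH_snd, opS_snd, map_sub,
      map_add, map_smul, J_J]
    module

theorem rep_opU_rep_inv (k : K) (v : D.Ind) : rep D k (opU D (rep D k⁻¹ v)) = opU D v := by
  refine ext (by simp) fun j => ?_
  rw [rep_snd, opU_snd, opU_snd, rep_snd, J_cx, map_smul, ← cx_mul, ← mul_pow, ← map_mul,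
    mul_inv_cancel, map_one, one_pow, map_one, Module.End.one_apply]

theorem ad_smul (k : K) (a : 𝔤) (v : D.Ind) :
    ι𝔤 (Ad k a) • v = rep D k (ι𝔤 a • rep D k⁻¹ v) := by
  rw [eq_combination a]
  simp only [Ad_add, Ad_smul, Ad_hElt, Ad_sElt, Ad_uElt, map_add, map_sub, map_smul, add_smul,
    sub_smul, smul_assoc, h_smul, s_smul, u_smul, rep_opH_rep_inv, rep_opS_rep_inv,
    rep_opU_rep_inv]

theorem casimir_smul (v : D.Ind) :
    casimir • v = opH D (opH D v) + opS D (opS D v) - opU D (opU D v) := by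
  simp only [casimir_eq, pow_two, sub_smul, add_smul, mul_smul, h_smul, s_smul, u_smul]

/-- The scalars depending on j cancel: h² + s² is 2(RL + LR) = 2T - 4(j+1)², with the usual change
through N0 in slot 0, and u² = -4(j+1)². -/
theorem casimir_inW (v : D.Ind) (j : ℕ) : (casimir • v).2 j = (2 : ℝ) • D.T (v.2 j) := by
  rw [casimir_smul]
  rcases j with _ | j
  · simp [-one_div, T_J]
    simp only [T_apply, map_sub, J_J]
    module
  · simp [-one_div, T_J]
    module

theorem casimir_fst (v : D.Ind) : (casimir • v).1 = (2 : ℝ) • D.Q (D.P v.1) := by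
  rw [casimir_smul]
  simp [-one_div, Q_T]
  module

theorem casimir_pow_snd (m : ℕ) (v : D.Ind) (j : ℕ) :
    (casimir ^ m • v).2 j = (2 : ℝ) ^ m • (D.T ^ m) (v.2 j) := by
  induction m generalizing v with
  | zero => simp
  | succ m ih =>
    rw [pow_succ, mul_smul, ih, casimir_inW, map_smul, smul_smul, pow_succ, pow_succ]
    rfl

theorem casimir_pow_fst (m : ℕ) (v : D.Ind) :
    (casimir ^ m • v).1 = (2 : ℝ) ^ m • ((D.Q ∘ₗ D.P) ^ m) v.1 := by
  induction m generalizing v with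
  | zero => simp
  | succ m ih =>
    rw [pow_succ, mul_smul, ih, casimir_fst, map_smul, smul_smul, pow_succ, pow_succ]
    rfl

variable (D)

theorem exists_casimir_pow : ∃ m : ℕ, ∀ v : D.Ind, casimir ^ m • v = 0 := by
  obtain ⟨a, ha⟩ := D.T_nilpotent
  obtain ⟨b, hb⟩ := D.nilpotent
  refine ⟨a + b, fun v => ext ?_ fun j => ?_⟩
  · rw [casimir_pow_fst, pow_add (D.Q ∘ₗ D.P), Module.End.mul_apply, hb]
    simp
  · rw [casimir_pow_snd, pow_add D.T, ha]
    simp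

theorem rep_negOne (v : D.Ind) : rep D negOne v = v :=
  ext rfl fun j => by simp [chi_negOne, pow_mul]

/-- The finite-dimensional parts of K-type 0 and 2 generate: h carries a slot onto the next one,
modulo lower slots. -/
theorem finite : Module.Finite U𝔤 D.Ind := by
  let V : Submodule ℝ D.Ind := LinearMap.range (inN D) ⊔ LinearMap.range (inW D 0)
  obtain ⟨s, hs⟩ : V.FG := Submodule.FG.sup (Module.Finite.iff_fg.1 inferInstance)
    (Module.Finite.iff_fg.1 inferInstance)
  have hV {v : D.Ind} (hv : v ∈ V) : v ∈ Submodule.span U𝔤 (s : Set D.Ind) := by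
    have : V ≤ (Submodule.span U𝔤 (s : Set D.Ind)).restrictScalars ℝ :=
      hs ▸ Submodule.span_le.2 Submodule.subset_span
    exact this hv
  have hN (n : D.N0) : inN D n ∈ Submodule.span U𝔤 (s : Set D.Ind) :=
    hV (Submodule.mem_sup_left ⟨n, rfl⟩)
  have hW (j : ℕ) : ∀ w, inW D j w ∈ Submodule.span U𝔤 (s : Set D.Ind) := by
    induction j using Nat.twoStepInduction with
    | zero => exact fun w => hV (Submodule.mem_sup_right ⟨w, rfl⟩)
    | one =>
      intro w
      rw [← sub_eq_iff_eq_add'.2 (opH_inW_zero w), ← h_smul]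
      exact sub_mem (Submodule.smul_mem _ _ (hV (Submodule.mem_sup_right ⟨w, rfl⟩))) (hN _)
    | more j h1 h2 =>
      intro w
      rw [← sub_eq_iff_eq_add'.2 (opH_inW_succ j w), ← h_smul]
      exact sub_mem (Submodule.smul_mem _ _ (h2 w)) (h1 _)
  exact ⟨⟨s, eq_top_iff.2 fun v _ => induction hN hW (fun _ _ => add_mem) v⟩⟩

theorem inN_mem_isotypic (n : D.N0) : inN D n ∈ isotypic (opU D) 0 := by
  rw [mem_isotypic, opU_inN]; simp

theorem inW_mem_isotypic (j : ℕ) (w : D.W) : inW D j w ∈ isotypic (opU D) (2 * (j + 1)) := by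
  rw [mem_isotypic, opU_inW, map_smul, opU_inW, J_J, map_neg, smul_smul, ← neg_one_smul ℝ,
    smul_smul]
  congr 1
  push_cast
  ring

end Ind

end GelfandDatum

/-! ### Admissibility of `Ind`, its morphisms, and the functor to the principal block -/

namespace GelfandDatum

namespace Ind

variable {D E : GelfandDatum.{u}}

theorem snd_eq_zero_of_isotypic {n : ℕ} {v : D.Ind} (hv : v ∈ isotypic (opU D) n) (j : ℕ)
    (hj : n ≠ 2 * (j + 1)) : v.2 j = 0 := by
  have h : (opU D (opU D v)).2 j = (-(n : ℝ) ^ 2 • v).2 j := by rw [mem_isotypic.1 hv]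
  rw [opU_snd, opU_snd, map_smul, J_J, smul_smul, smul_neg, smul_snd, Finsupp.smul_apply,
    ← neg_smul, ← sub_eq_zero, ← sub_smul] at h
  refine (smul_eq_zero.1 h).resolve_left fun h2 => hj ?_
  have h3 : (n : ℝ) ^ 2 = ((2 * (j + 1) : ℕ) : ℝ) ^ 2 := by
    push_cast
    linear_combination h2
  exact Nat.pow_left_injective two_ne_zero (by exact_mod_cast h3)

theorem fst_eq_zero_of_isotypic {n : ℕ} {v : D.Ind} (hv : v ∈ isotypic (opU D) n)
    (hn : n ≠ 0) : v.1 = 0 := by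
  have h : (opU D (opU D v)).1 = (-(n : ℝ) ^ 2 • v).1 := by rw [mem_isotypic.1 hv]
  rw [opU_fst, smul_fst] at h
  exact (smul_eq_zero.1 h.symm).resolve_left (by simpa using hn)

theorem eq_inN_of_isotypic {v : D.Ind} (hv : v ∈ isotypic (opU D) 0) : v = inN D v.1 :=
  ext rfl fun j => snd_eq_zero_of_isotypic hv j (by omega)

theorem eq_inW_of_isotypic {j : ℕ} {v : D.Ind} (hv : v ∈ isotypic (opU D) (2 * (j + 1))) :
    v = inW D j (v.2 j) := by
  refine ext (fst_eq_zero_of_isotypic hv (by omega)) fun i => ?_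
  by_cases h : j = i
  · subst h; simp
  · rw [snd_eq_zero_of_isotypic hv i (by omega)]
    simp [h]

variable (D)

theorem isGenerator : IsGenerator (rep D) (opU D) := by
  intro n v hv k
  refine ext ?_ fun j => ?_
  · by_cases hn : n = 0
    · subst hn; simp
    · simp [fst_eq_zero_of_isotypic hv hn]
  · by_cases hn : n = 2 * (j + 1)
    · subst hn
      rw [rep_snd, cx_apply, add_snd, smul_snd, smul_snd, Finsupp.add_apply, Finsupp.smul_apply,
        Finsupp.smul_apply, opU_snd, smul_smul]
      push_cast
      rw [div_mul_cancel₀ _ (by positivity)]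
    · simp [snd_eq_zero_of_isotypic hv j hn]

theorem isotypic_eq_top : iSup (isotypic (opU D)) = ⊤ :=
  eq_top_iff.2 fun v _ => induction
    (fun n => Submodule.mem_iSup_of_mem 0 (inN_mem_isotypic D n))
    (fun j w => Submodule.mem_iSup_of_mem _ (inW_mem_isotypic D j w)) (fun _ _ => add_mem) v

theorem finiteDimensional_isotypic (n : ℕ) : FiniteDimensional ℝ (isotypic (opU D) n) := by
  -- For n = 2(j+1) the index n/2 - 1 is j. For any other n all slots vanish on the component, so
  -- the value of the truncated expression is immaterial.
  refine FiniteDimensional.of_injective ((LinearMap.prod (fst D)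
    (Finsupp.lapply (n / 2 - 1) ∘ₗ snd D)) ∘ₗ (isotypic (opU D) n).subtype)
    fun v w h => ?_
  have h : (v.1.1, v.1.2 (n / 2 - 1)) = (w.1.1, w.1.2 (n / 2 - 1)) := h
  refine Subtype.ext (ext (Prod.mk.inj h).1 fun j => ?_)
  by_cases hn : n = 2 * (j + 1)
  · have h2 := (Prod.mk.inj h).2
    have hj : n / 2 - 1 = j := by omega
    rw [hj] at h2
    exact h2
  · rw [snd_eq_zero_of_isotypic v.2 j hn, snd_eq_zero_of_isotypic w.2 j hn]

theorem isAdmissible : IsAdmissible (rep D) :=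
  isAdmissible_of_isotypic (opU D) (isGenerator D) (isotypic_eq_top D)
    (finiteDimensional_isotypic D)

variable {D}

/-- The linear map induced by a morphism of Gelfand data. -/
def map (f : D ⟶ E) : D.Ind →ₗ[ℝ] E.Ind :=
  pair (f.1.1 ∘ₗ fst D) (Finsupp.mapRange.linearMap f.1.2 ∘ₗ snd D)

@[simp] theorem map_fst (f : D ⟶ E) (v : D.Ind) : (map f v).1 = f.1.1 v.1 := rfl
@[simp] theorem map_snd (f : D ⟶ E) (v : D.Ind) (j : ℕ) : (map f v).2 j = f.1.2 (v.2 j) := rfl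

theorem raise_map (f : D ⟶ E) (v : D.Ind) (j : ℕ) :
    raise E (map f v) j = f.1.2 (raise D v j) := by
  rcases j with _ | j
  · simp [f.2.2.1]
  · simp

theorem lower_map (f : D ⟶ E) (v : D.Ind) (j : ℕ) :
    lower E (map f v).2 j = f.1.2 (lower D v.2 j) := by
  simp [hom_T]

theorem map_mem (f : D ⟶ E) : (∀ (a : U𝔤) (v : D.Ind), map f (a • v) = a • map f v) ∧
    ∀ (k : K) (v : D.Ind), map f (rep D k v) = rep E k (map f v) := by
  refine ⟨map_smul_U _ (fun v => ?_) (fun v => ?_) (fun v => ?_), fun k v => ?_⟩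
  · rw [h_smul, h_smul]
    refine ext (by simp [f.2.2.2]) fun j => ?_
    rw [map_snd, opH_snd, opH_snd, raise_map, lower_map, map_add]
  · rw [s_smul, s_smul]
    refine ext (by simp [f.2.2.2, f.2.1]) fun j => ?_
    rw [map_snd, opS_snd, opS_snd, raise_map, lower_map, f.2.1, map_sub]
  · rw [u_smul, u_smul]
    exact ext (by simp) fun j => by simp [f.2.1]
  · exact ext rfl fun j => by rw [map_snd, rep_snd, hom_cx, rep_snd, map_snd]

theorem map_inN (f : D ⟶ E) (n : D.N0) : map f (inN D n) = inN E (f.1.1 n) :=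
  ext rfl fun j => by simp

theorem map_inW (f : D ⟶ E) (j : ℕ) (w : D.W) : map f (inW D j w) = inW E j (f.1.2 w) := by
  refine ext (by simp) fun i => ?_
  by_cases h : j = i
  · subst h; simp
  · simp [h]

theorem inW_injective (j : ℕ) : Function.Injective (inW D j) := fun v w h => by
  have : (inW D j v).2 j = (inW D j w).2 j := by rw [h]
  simpa using this

/-- Commuting with u makes `g` diagonal with respect to K-types. Commuting with h, whose raising
part is the identity from slot to slot, then forces the same map in every slot; the relations with
J, P, Q come from the lowest components. -/
theorem exists_map_eq (g : D.Ind →ₗ[ℝ] E.Ind)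
    (hg : ∀ (a : U𝔤) (v : D.Ind), g (a • v) = a • g v) : ∃ f : D ⟶ E, map f = g := by
  have hU (v : D.Ind) : g (opU D v) = opU E (g v) := by rw [← u_smul, hg, u_smul]
  have hH (v : D.Ind) : g (opH D v) = opH E (g v) := by rw [← h_smul, hg, h_smul]
  have hiso {n : ℕ} {v : D.Ind} (hv : v ∈ isotypic (opU D) n) : g v ∈ isotypic (opU E) n := by
    rw [mem_isotypic] at hv ⊢
    rw [← hU, ← hU, hv, map_smul]
  let f0 : D.N0 →ₗ[ℝ] E.N0 := fst E ∘ₗ g ∘ₗ inN D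
  let f1 (j : ℕ) : D.W →ₗ[ℝ] E.W := Finsupp.lapply j ∘ₗ snd E ∘ₗ g ∘ₗ inW D j
  have h0 (n : D.N0) : g (inN D n) = inN E (f0 n) :=
    eq_inN_of_isotypic (hiso (inN_mem_isotypic D n))
  have h1 (j : ℕ) (w : D.W) : g (inW D j w) = inW E j (f1 j w) :=
    eq_inW_of_isotypic (hiso (inW_mem_isotypic D j w))
  have h2 (w : D.W) := hH (inW D 0 w)
  simp_rw [opH_inW_zero, h1, opH_inW_zero, map_add, h0, h1] at h2
  have h3 (j : ℕ) (w : D.W) : f1 j w = f1 0 w := by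
    induction j with
    | zero => rfl
    | succ j ih =>
      rw [← ih]
      rcases j with _ | j
      · have := congrArg (fun v => v.2 1) (h2 w)
        simpa using this
      · have := hH (inW D (j + 1) w)
        rw [opH_inW_succ, h1, opH_inW_succ, map_add, h1, h1] at this
        have := congrArg (fun v => v.2 (j + 2)) this
        simpa using this
  refine ⟨⟨(f0, f1 0), fun w => ?_, fun n => ?_, fun w => ?_⟩, ?_⟩
  · have := hU (inW D 0 w)
    rw [opU_inW, map_smul, h1, h1, opU_inW] at this
    exact inW_injective 0 (smul_right_injective _ (by norm_num) this)
  · have := hH (inN D n)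
    rw [opH_inN, h1, h0, opH_inN] at this
    exact inW_injective 0 this
  · have := congrArg (fun v => v.1) (h2 w)
    simpa using this
  · refine LinearMap.ext fun v => ?_
    induction v using induction with
    | hN n => rw [map_inN, h0]
    | hW j w => rw [map_inW, h1, h3 j w]
    | hadd v w hv hw => rw [map_add, map_add, hv, hw]

end Ind

/-- The Harish-Chandra module of a Gelfand datum. -/
def toHC (D : GelfandDatum.{u}) : HCModule.{u} where
  carrier := D.Ind
  ρ := Ind.rep D
  finite := Ind.finite D
  admissible := Ind.isAdmissible D
  deriv_exp := Ind.hasDerivAt_rep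
  ad_smul := Ind.ad_smul

/-- The functor from Gelfand data to the principal block. -/
def toPrincipalBlock : GelfandDatum.{u} ⥤ PrincipalBlock.{u} where
  obj D := ⟨D.toHC, Ind.exists_casimir_pow D, Ind.rep_negOne D⟩
  map f := ObjectProperty.homMk ⟨Ind.map f, Ind.map_mem f⟩
  map_id D := by
    apply ObjectProperty.hom_ext
    exact Subtype.ext (LinearMap.ext fun v => Ind.ext rfl fun j => rfl)
  map_comp f g := by
    apply ObjectProperty.hom_ext
    exact Subtype.ext (LinearMap.ext fun v => Ind.ext rfl fun j => rfl)

instance : toPrincipalBlock.{u}.Additive where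
  map_add {D E f g} := by
    apply ObjectProperty.hom_ext
    exact Subtype.ext (LinearMap.ext fun v => Ind.ext rfl fun j => rfl)

instance : toPrincipalBlock.{u}.Linear ℝ where
  map_smul {D E} f r := by
    apply ObjectProperty.hom_ext
    exact Subtype.ext (LinearMap.ext fun v => Ind.ext rfl fun j => rfl)

instance : toPrincipalBlock.{u}.Faithful where
  map_injective {D E f g} h := by
    have h2 : Ind.map f = Ind.map g := congrArg (fun φ => φ.hom.1) h
    refine hom_ext (fun n => ?_) fun w => ?_
    · have := congrArg (fun φ : D.Ind →ₗ[ℝ] E.Ind => (φ (Ind.inN D n)).1) h2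
      simpa using this
    · have := congrArg (fun φ : D.Ind →ₗ[ℝ] E.Ind => (φ (Ind.inW D 0 w)).2 0) h2
      simpa using this

instance : toPrincipalBlock.{u}.Full where
  map_surjective {D E} g := by
    obtain ⟨f, hf⟩ := Ind.exists_map_eq g.hom.1 g.hom.2.1
    refine ⟨f, ?_⟩
    apply ObjectProperty.hom_ext
    exact Subtype.ext hf

end GelfandDatum

/-! ## The operators of a Harish-Chandra module -/

section

variable (M : Type u) [AddCommGroup M] [Module ℝ M] [Module U𝔤 M] [IsScalarTower ℝ U𝔤 M]

/-- The action of an element of `U(𝔤)` as a real-linear map. -/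
def act (a : U𝔤) : Module.End ℝ M := Algebra.lsmul ℝ ℝ M a

/-- The action of `h`. -/
def actH : Module.End ℝ M := act M (ι𝔤 hElt)

/-- The action of `x + y`. -/
def actS : Module.End ℝ M := act M (ι𝔤 sElt)

/-- The action of `x - y`. -/
def actU : Module.End ℝ M := act M (ι𝔤 uElt)

variable {M}

theorem actH_apply (v : M) : actH M v = ι𝔤 hElt • v := rfl

theorem actS_apply (v : M) : actS M v = ι𝔤 sElt • v := rfl

theorem actU_apply (v : M) : actU M v = ι𝔤 uElt • v := rfl

theorem actH_actS (v : M) : actH M (actS M v) = actS M (actH M v) + (2 : ℝ) • actU M v := by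
  simp only [actH_apply, actS_apply, actU_apply, ← mul_smul]
  rw [← smul_assoc, ← map_smul, ← lie_h_s, ← lie_U, ← add_smul, add_sub_cancel]

theorem actU_actH (v : M) : actU M (actH M v) = actH M (actU M v) - (2 : ℝ) • actS M v := by
  simp only [actH_apply, actS_apply, actU_apply, ← mul_smul]
  rw [sub_eq_add_neg, ← neg_smul, ← smul_assoc, ← map_smul, ← lie_u_h, ← lie_U, ← add_smul,
    add_sub_cancel]

theorem actU_actS (v : M) : actU M (actS M v) = actS M (actU M v) + (2 : ℝ) • actH M v := by
  simp only [actH_apply, actS_apply, actU_apply, ← mul_smul]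
  rw [← smul_assoc, ← map_smul, ← lie_u_s, ← lie_U, ← add_smul, add_sub_cancel]

variable (M) in
/-- The action of the Casimir element. -/
def actC : Module.End ℝ M := act M casimir

theorem actC_apply (v : M) :
    actC M v = actH M (actH M v) + actS M (actS M v) - actU M (actU M v) := by
  change casimir • v = _
  simp only [casimir_eq, actH_apply, actS_apply, actU_apply, pow_two, sub_smul, add_smul, mul_smul]

theorem actC_pow (m : ℕ) (v : M) : (actC M ^ m) v = casimir ^ m • v := by
  rw [actC, act, ← map_pow]; rfl

theorem actC_actH (v : M) : actC M (actH M v) = actH M (actC M v) := by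
  simp only [actC_apply, actH_actS, actU_actH, actU_actS, map_add, map_sub, map_smul]
  module

theorem actC_actS (v : M) : actC M (actS M v) = actS M (actC M v) := by
  simp only [actC_apply, actH_actS, actU_actH, actU_actS, map_add, map_sub, map_smul]
  module

theorem actC_actU (v : M) : actC M (actU M v) = actU M (actC M v) := by
  simp only [actC_apply, actH_actS, actU_actH, actU_actS, map_add, map_sub, map_smul]
  module

/-! ### Raising and lowering operators in real form -/

variable (M) in
/-- The raising operator, as a function of a vector `v` and of its rotation `v'`. -/
def up : M × M →ₗ[ℝ] M :=
  (1 / 2 : ℝ) • (actH M ∘ₗ LinearMap.fst ℝ M M + actS M ∘ₗ LinearMap.snd ℝ M M)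

variable (M) in
/-- The lowering operator, as a function of a vector `v` and of its rotation `v'`. -/
def down : M × M →ₗ[ℝ] M :=
  (1 / 2 : ℝ) • (actH M ∘ₗ LinearMap.fst ℝ M M - actS M ∘ₗ LinearMap.snd ℝ M M)

theorem up_apply (v v' : M) : up M (v, v') = (1 / 2 : ℝ) • (actH M v + actS M v') := rfl

theorem down_apply (v v' : M) : down M (v, v') = (1 / 2 : ℝ) • (actH M v - actS M v') := rfl

theorem actH_eq (v v' : M) : actH M v = down M (v, v') + up M (v, v') := by
  rw [up_apply, down_apply]; module

/-- The hypotheses say that v + iv' is an eigenvector of u for -im in the complexification. The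
values of `up` at (v, v') and (v', -v) are the real and imaginary parts of (h - is)(v + iv')/2, and
[u, h - is] = -2i(h - is). -/
theorem actU_up {v v' : M} {m : ℝ} (h : actU M v = m • v') (h' : actU M v' = -m • v) :
    actU M (up M (v, v')) = (m + 2) • up M (v', -v) := by
  simp only [up_apply, map_smul, map_add, actU_actH, actU_actS, h, h', map_neg]
  module

theorem actU_down {v v' : M} {m : ℝ} (h : actU M v = m • v') (h' : actU M v' = -m • v) :
    actU M (down M (v, v')) = (m - 2) • down M (v', -v) := by
  simp only [down_apply, map_smul, map_sub, actU_actH, actU_actS, h, h', map_neg]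
  module

/-- This is (h + is)(h - is) = c + u² - 2iu, evaluated at u = -im and divided by 4. -/
theorem down_up {v v' : M} {m : ℝ} (h : actU M v = m • v') (h' : actU M v' = -m • v) :
    down M (up M (v, v'), up M (v', -v)) =
      (1 / 4 : ℝ) • actC M v - ((m * (m + 2)) / 4 : ℝ) • v := by
  simp only [actC_apply, down_apply, up_apply, map_smul, map_add, actH_actS, h, h', map_neg]
  module

theorem up_down {v v' : M} {m : ℝ} (h : actU M v = m • v') (h' : actU M v' = -m • v) :
    up M (down M (v, v'), down M (v', -v)) =
      (1 / 4 : ℝ) • actC M v - ((m * (m - 2)) / 4 : ℝ) • v := by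
  simp only [actC_apply, down_apply, up_apply, map_smul, map_sub, actH_actS, h, h', map_neg]
  module

theorem actC_up (v v' : M) : actC M (up M (v, v')) = up M (actC M v, actC M v') := by
  simp only [up_apply, map_smul, map_add, actC_actH, actC_actS]

/-- N - a is surjective for nilpotent N and a ≠ 0. If z solves the equation for Ny, then (z - y)/a
solves it for y; this replaces the geometric series. -/
theorem exists_sub_smul_eq {V : Type*} [AddCommGroup V] [Module ℝ V] (N : Module.End ℝ V) {a : ℝ}
    (ha : a ≠ 0) (Y : Submodule ℝ V) (hY : ∀ y ∈ Y, N y ∈ Y) (m : ℕ) (y : V) (hy : y ∈ Y) (hm : (N ^ m) y = 0) :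
    ∃ z ∈ Y, N z - a • z = y := by
  induction m generalizing y with
  | zero => exact ⟨0, Y.zero_mem, by simpa using hm.symm⟩
  | succ m ih =>
    obtain ⟨z, hz, h⟩ := ih (N y) (hY y hy) hm
    refine ⟨a⁻¹ • (z - y), Y.smul_mem _ (Y.sub_mem hz hy), ?_⟩
    rw [map_smul, map_sub, ← h, smul_smul, mul_inv_cancel₀ ha, sub_sub_cancel, smul_smul,
      inv_mul_cancel₀ ha]
    module

theorem eq_zero_of_nilpotent {V : Type*} [AddCommGroup V] [Module ℝ V] (N : Module.End ℝ V) {a : ℝ}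
    (ha : a ≠ 0) (m : ℕ) (w : V) (hm : (N ^ m) w = 0) (h : N w = a • w) : w = 0 := by
  have h2 : (N ^ m) w = a ^ m • w := by
    clear hm
    induction m with
    | zero => simp
    | succ m ih => rw [pow_succ, Module.End.mul_apply, h, map_smul, ih, smul_smul, pow_succ']
  rw [h2] at hm
  exact (smul_eq_zero.1 hm).resolve_left (pow_ne_zero _ ha)

/-- The projections to the isotypic components. -/
theorem exists_isotypic_projection {V : Type u} [AddCommGroup V] [Module ℝ V] (U : Module.End ℝ V)
    (h : iSup (isotypic U) = ⊤) : ∃ π : ℕ → V →ₗ[ℝ] V,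
      (∀ n, ∀ v ∈ isotypic U n, π n v = v) ∧ ∀ n m, ∀ v ∈ isotypic U m, m ≠ n → π n v = 0 := by
  have hint : DirectSum.IsInternal (isotypic U) :=
    DirectSum.isInternal_submodule_of_iSupIndep_of_iSup_eq_top (isotypic_independent U) h
  let E : (⨁ n, isotypic U n) ≃ₗ[ℝ] V := LinearEquiv.ofBijective (DirectSum.coeLinearMap _) hint
  have hE {n : ℕ} {v : V} (hv : v ∈ isotypic U n) :
      E.symm v = DirectSum.of (fun n => isotypic U n) n ⟨v, hv⟩ := by
    rw [LinearEquiv.symm_apply_eq]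
    exact (DirectSum.coeLinearMap_of _ n ⟨v, hv⟩).symm
  refine ⟨fun n => (isotypic U n).subtype ∘ₗ DirectSum.component ℝ ℕ _ n ∘ₗ E.symm.toLinearMap,
    fun n v hv => ?_, fun n m v hv hn => ?_⟩
  · change ((E.symm v n : isotypic U n) : V) = v
    rw [hE hv, DirectSum.of_eq_same]
  · change ((E.symm v n : isotypic U n) : V) = 0
    rw [hE hv, DirectSum.of_eq_of_ne _ _ _ hn.symm]
    rfl

end

namespace HCModule

/-! ## The Gelfand datum of a Harish-Chandra module -/

variable (M : HCModule.{u})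

theorem isotypic_actU : IsGenerator M.ρ (actU M.carrier) ∧
    iSup (isotypic (actU M.carrier)) = ⊤ ∧
      ∀ n, FiniteDimensional ℝ (isotypic (actU M.carrier) n) :=
  isotypic_of_isAdmissible M.admissible _ (M.deriv_exp uElt uElt_skew)

variable {M}

/-- Membership only gives u²v = 0. That u itself kills v follows because K fixes v, so that the
derivative of its orbit is zero. -/
theorem actU_eq_zero {v : M.carrier} (hv : v ∈ isotypic (actU M.carrier) 0) :
    actU M.carrier v = 0 := by
  refine (Module.forall_dual_apply_eq_zero_iff ℝ _).1 fun φ => ?_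
  have h := M.deriv_exp uElt uElt_skew v φ
  have h2 (k : K) : M.ρ k v = v := by
    rw [M.isotypic_actU.1 0 v hv k]; simp
  simp_rw [h2] at h
  exact h.unique (hasDerivAt_const _ _)

theorem mem_isotypic_of {n : ℕ} {v v' : M.carrier} (h : actU M.carrier v = (n : ℝ) • v')
    (h' : actU M.carrier v' = -(n : ℝ) • v) : v ∈ isotypic (actU M.carrier) n := by
  rw [mem_isotypic, h, map_smul, h', smul_smul]
  congr 1
  ring

variable (M)

/-- The complex structure on the component of `K`-type `2`. -/
def rot : Module.End ℝ (isotypic (actU M.carrier) 2) :=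
  (1 / 2 : ℝ) • (actU M.carrier).restrict (fun _ hv => map_mem_isotypic hv)

variable {M}

theorem coe_rot (w : isotypic (actU M.carrier) 2) :
    (M.rot w : M.carrier) = (1 / 2 : ℝ) • actU M.carrier w := rfl

theorem actU_coe (w : isotypic (actU M.carrier) 2) :
    actU M.carrier w = (2 : ℝ) • (M.rot w : M.carrier) := by
  rw [coe_rot, smul_smul]; norm_num

theorem rot_rot (w : isotypic (actU M.carrier) 2) : M.rot (M.rot w) = -w := by
  apply Subtype.ext
  rw [coe_rot, coe_rot, map_smul, mem_isotypic.1 w.2, smul_smul, smul_smul]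
  norm_num

theorem actU_rot (w : isotypic (actU M.carrier) 2) :
    actU M.carrier (M.rot w) = -(2 : ℝ) • (w : M.carrier) := by
  rw [actU_coe, rot_rot]; simp

theorem actH_mem {n : M.carrier} (hn : n ∈ isotypic (actU M.carrier) 0) :
    actH M.carrier n ∈ isotypic (actU M.carrier) 2 := by
  apply mem_isotypic_of (v' := -actS M.carrier n)
  · rw [actU_actH, actU_eq_zero hn]; simp
  · rw [map_neg, actU_actS, actU_eq_zero hn]; simp

theorem down_mem (w : isotypic (actU M.carrier) 2) :
    down M.carrier (w, M.rot w) ∈ isotypic (actU M.carrier) 0 := by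
  rw [mem_isotypic, actU_down (actU_coe w) (actU_rot w)]
  simp

variable (M) in
/-- The map from `K`-type `0` to `K`-type `2`. -/
def mapP : isotypic (actU M.carrier) 0 →ₗ[ℝ] isotypic (actU M.carrier) 2 :=
  (actH M.carrier).restrict (fun _ hn => actH_mem hn)

variable (M) in
/-- The map from `K`-type `2` to `K`-type `0`. -/
def mapQ : isotypic (actU M.carrier) 2 →ₗ[ℝ] isotypic (actU M.carrier) 0 :=
  LinearMap.codRestrict _ (down M.carrier ∘ₗ
    LinearMap.prod (isotypic (actU M.carrier) 2).subtype
      ((isotypic (actU M.carrier) 2).subtype ∘ₗ M.rot)) down_mem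

theorem coe_mapP (n : isotypic (actU M.carrier) 0) :
    (M.mapP n : M.carrier) = actH M.carrier n := rfl

theorem coe_mapQ (w : isotypic (actU M.carrier) 2) :
    (M.mapQ w : M.carrier) = down M.carrier (w, M.rot w) := rfl

theorem rot_mapP (n : isotypic (actU M.carrier) 0) :
    (M.rot (M.mapP n) : M.carrier) = -actS M.carrier n := by
  rw [coe_rot, coe_mapP, actU_actH, actU_eq_zero n.2]
  simp [smul_smul]

/-- Up to sign this is half of [h, s]n = 2un, and u kills K-type 0. -/
theorem mapQ_rot_mapP (n : isotypic (actU M.carrier) 0) : M.mapQ (M.rot (M.mapP n)) = 0 := by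
  apply Subtype.ext
  rw [coe_mapQ, rot_rot, rot_mapP, Submodule.coe_neg, coe_mapP, down_apply, map_neg, map_neg,
    actH_actS, actU_eq_zero n.2]
  simp

/-- On K-type 0 the Casimir element reduces to h² + s². Its nilpotency thus becomes that of QP. -/
theorem mapQ_mapP (n : isotypic (actU M.carrier) 0) :
    (M.mapQ (M.mapP n) : M.carrier) = (1 / 2 : ℝ) • actC M.carrier n := by
  rw [coe_mapQ, rot_mapP, coe_mapP, down_apply, map_neg, actC_apply, actU_eq_zero n.2]
  simp

theorem mapQ_mapP_pow (m : ℕ) (n : isotypic (actU M.carrier) 0) :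
    ((((M.mapQ ∘ₗ M.mapP) ^ m) n : isotypic (actU M.carrier) 0) : M.carrier) =
      (1 / 2 : ℝ) ^ m • (actC M.carrier ^ m) n := by
  induction m generalizing n with
  | zero => simp
  | succ m ih =>
    rw [pow_succ, Module.End.mul_apply, ih, LinearMap.comp_apply, mapQ_mapP, map_smul, smul_smul,
      pow_succ, pow_succ]
    rfl

variable (M)

/-- The Gelfand datum of a module in the principal block. -/
def datum (hM : isPrincipal M) : GelfandDatum.{u} :=
  have := M.isotypic_actU.2.2 0
  have := M.isotypic_actU.2.2 2
  { N0 := isotypic (actU M.carrier) 0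
    W := isotypic (actU M.carrier) 2
    J := M.rot
    P := M.mapP
    Q := M.mapQ
    J_J := rot_rot
    Q_J_P := mapQ_rot_mapP
    nilpotent := by
      obtain ⟨m, hm⟩ := hM.1
      exact ⟨m, fun n => Subtype.ext (by rw [mapQ_mapP_pow, actC_pow, hm]; simp)⟩ }

end HCModule

/-- An identification of a Gelfand datum with the components of `K`-type `0` and `2` of a
Harish-Chandra module. -/
structure Realization (D : GelfandDatum.{u}) (M : HCModule.{u}) where
  onN : D.N0 →ₗ[ℝ] M.carrier
  onW : D.W →ₗ[ℝ] M.carrier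
  onN_injective : Function.Injective onN
  onW_injective : Function.Injective onW
  range_onN : LinearMap.range onN = isotypic (actU M.carrier) 0
  range_onW : LinearMap.range onW = isotypic (actU M.carrier) 2
  actU_onW : ∀ w, actU M.carrier (onW w) = (2 : ℝ) • onW (D.J w)
  onW_P : ∀ n, onW (D.P n) = actH M.carrier (onN n)
  onN_Q : ∀ w, onN (D.Q w) = down M.carrier (onW w, onW (D.J w))

/-- The datum of a module in the principal block is realized in the module. -/
def HCModule.realization {M : HCModule.{u}} (hM : isPrincipal M) : Realization (M.datum hM) M where
  onN := (isotypic (actU M.carrier) 0).subtype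
  onW := (isotypic (actU M.carrier) 2).subtype
  onN_injective := Subtype.val_injective
  onW_injective := Subtype.val_injective
  range_onN := Submodule.range_subtype _
  range_onW := Submodule.range_subtype _
  actU_onW := HCModule.actU_coe
  onW_P _ := rfl
  onN_Q _ := rfl

/-! ### The comparison isomorphism with the induced module -/

namespace Realization

variable {D : GelfandDatum.{u}} {M : HCModule.{u}} (r : Realization D M)

theorem onN_mem (n : D.N0) : r.onN n ∈ isotypic (actU M.carrier) 0 :=
  r.range_onN ▸ LinearMap.mem_range_self _ n

theorem onW_mem (w : D.W) : r.onW w ∈ isotypic (actU M.carrier) 2 :=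
  r.range_onW ▸ LinearMap.mem_range_self _ w

theorem onW_J_P (n : D.N0) : r.onW (D.J (D.P n)) = -actS M.carrier (r.onN n) := by
  have h := r.actU_onW (D.P n)
  rw [r.onW_P, actU_actH, HCModule.actU_eq_zero (r.onN_mem n), map_zero, zero_sub, ← smul_neg] at h
  exact (smul_right_injective _ two_ne_zero h).symm

theorem onW_T (w : D.W) : r.onW (D.T w) = (1 / 2 : ℝ) • actC M.carrier (r.onW w) := by
  have h := r.actU_onW (D.J w)
  rw [D.J_J, map_neg] at h
  rw [D.T_apply, map_sub, r.onW_J_P, r.onW_P, r.onN_Q, r.onN_Q, D.J_J, actC_apply,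
    mem_isotypic.1 (r.onW_mem w)]
  simp only [down_apply, map_smul, map_sub, actH_actS, map_neg, h]
  module

/-- The iterated raising operators on the component of `K`-type `2`. -/
def raising : ℕ → D.W →ₗ[ℝ] M.carrier
  | 0 => r.onW
  | j + 1 => up M.carrier ∘ₗ LinearMap.prod (raising j) (raising j ∘ₗ D.J)

theorem raising_zero (w : D.W) : r.raising 0 w = r.onW w := rfl

theorem raising_succ (j : ℕ) (w : D.W) :
    r.raising (j + 1) w = up M.carrier (r.raising j w, r.raising j (D.J w)) := rfl

theorem raising_succ_rot (j : ℕ) (w : D.W) :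
    r.raising (j + 1) (D.J w) = up M.carrier (r.raising j (D.J w), -r.raising j w) := by
  rw [r.raising_succ, D.J_J, map_neg]

theorem actU_raising (j : ℕ) (w : D.W) :
    actU M.carrier (r.raising j w) = (2 * (j + 1) : ℝ) • r.raising j (D.J w) := by
  induction j generalizing w with
  | zero => rw [r.raising_zero, r.raising_zero, r.actU_onW]; simp
  | succ j ih =>
    have h := ih (D.J w)
    rw [D.J_J, map_neg, smul_neg, ← neg_smul] at h
    rw [r.raising_succ, actU_up (ih w) h, r.raising_succ_rot]
    congr 1
    push_cast
    ring

theorem actU_raising_rot (j : ℕ) (w : D.W) :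
    actU M.carrier (r.raising j (D.J w)) = -(2 * (j + 1) : ℝ) • r.raising j w := by
  rw [r.actU_raising, D.J_J, map_neg, smul_neg, neg_smul]

theorem raising_mem (j : ℕ) (w : D.W) :
    r.raising j w ∈ isotypic (actU M.carrier) (2 * (j + 1)) := by
  apply HCModule.mem_isotypic_of (v' := r.raising j (D.J w))
  · rw [r.actU_raising]; push_cast; rfl
  · rw [r.actU_raising_rot]; push_cast; rfl

theorem actC_raising (j : ℕ) (w : D.W) :
    actC M.carrier (r.raising j w) = (2 : ℝ) • r.raising j (D.T w) := by
  induction j generalizing w with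
  | zero =>
    rw [r.raising_zero, r.raising_zero, r.onW_T, smul_smul]
    norm_num
  | succ j ih =>
    rw [r.raising_succ, actC_up, ih, ih (D.J w), r.raising_succ, D.T_J, ← map_smul (up M.carrier)]
    rfl

/-- This is `down_up` for m = 2(j+1) with c = 2T. It is the source of the constants in the
definition of `lower`. -/
theorem down_raising_succ (j : ℕ) (w : D.W) :
    down M.carrier (r.raising (j + 1) w, r.raising (j + 1) (D.J w)) =
      r.raising j ((1 / 2 : ℝ) • D.T w - ((j + 1) * (j + 2) : ℝ) • w) := by
  rw [r.raising_succ_rot, r.raising_succ, down_up (r.actU_raising j w) (r.actU_raising_rot j w),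
    r.actC_raising, map_sub, map_smul, map_smul]
  module

/-- The comparison map from the module of the datum of `M` to `M`. -/
def comparison : D.Ind →ₗ[ℝ] M.carrier :=
  r.onN ∘ₗ GelfandDatum.Ind.fst D + Finsupp.lsum ℝ r.raising ∘ₗ GelfandDatum.Ind.snd D

open GelfandDatum Ind

theorem comparison_inN (n : D.N0) :
    r.comparison (inN D n) = r.onN n := by
  simp [comparison]

theorem comparison_inW (j : ℕ) (w : D.W) :
    r.comparison (inW D j w) = r.raising j w := by
  simp [comparison]

theorem comparison_opU (v : D.Ind) :
    r.comparison (opU _ v) = actU M.carrier (r.comparison v) := by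
  induction v using Ind.induction with
  | hN n => rw [opU_inN, map_zero, r.comparison_inN]; exact (HCModule.actU_eq_zero (r.onN_mem n)).symm
  | hW j w =>
    rw [opU_inW, map_smul, r.comparison_inW, r.comparison_inW, r.actU_raising]
  | hadd v w hv hw => simp only [map_add, hv, hw]

theorem comparison_opH (v : D.Ind) :
    r.comparison (opH _ v) = actH M.carrier (r.comparison v) := by
  induction v using Ind.induction with
  | hN n => rw [opH_inN, r.comparison_inN, r.comparison_inW, r.raising_zero, r.onW_P]
  | hW j w =>
    rw [r.comparison_inW, actH_eq _ (r.raising j (D.J w)), ← r.raising_succ]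
    rcases j with _ | j
    · rw [opH_inW_zero, map_add, r.comparison_inN, r.comparison_inW, r.onN_Q]; rfl
    · rw [opH_inW_succ, map_add, r.comparison_inW, r.comparison_inW, r.down_raising_succ]
  | hadd v w hv hw => simp only [map_add, hv, hw]

/-- No computation is needed, since s is recovered from u and h by [u, h] = -2s. -/
theorem comparison_opS (v : D.Ind) :
    r.comparison (opS _ v) = actS M.carrier (r.comparison v) := by
  have h1 := opU_opH v
  have h2 := actU_actH (r.comparison v)
  rw [← r.comparison_opH, ← r.comparison_opU, ← r.comparison_opU, ← r.comparison_opH,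
    eq_sub_iff_add_eq, ← eq_sub_iff_add_eq', ← map_sub] at h2
  have h3 : opH _ (opU _ v) - opU _ (opH _ v) = (2 : ℝ) • opS _ v := by
    rw [← neg_sub, h1, neg_smul, neg_neg]
  rw [h3, map_smul] at h2
  exact (smul_right_injective _ two_ne_zero h2).symm

theorem comparison_mem :
    (∀ (a : U𝔤) (v : D.Ind), r.comparison (a • v) = a • r.comparison v) ∧
    ∀ (k : K) (v : D.Ind), r.comparison (rep _ k v) = M.ρ k (r.comparison v) := by
  refine ⟨map_smul_U _ (fun v => ?_) (fun v => ?_) (fun v => ?_), fun k v => ?_⟩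
  · rw [h_smul, r.comparison_opH]; rfl
  · rw [s_smul, r.comparison_opS]; rfl
  · rw [u_smul, r.comparison_opU]; rfl
  · induction v using Ind.induction with
    | hN n =>
      rw [rep_inN, r.comparison_inN, M.isotypic_actU.1 0 _ (r.onN_mem n) k]
      simp
    | hW j w =>
      rw [rep_inW, r.comparison_inW, r.comparison_inW, M.isotypic_actU.1 _ _ (r.raising_mem j w) k,
        cx_apply, map_add, map_smul, map_smul, r.actU_raising, smul_smul]
      push_cast
      rw [div_mul_cancel₀ _ (by positivity)]
    | hadd v w hv hw => simp only [map_add, hv, hw]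

/-- Lowering a vanishing vector and using injectivity one step below gives Tw = 2(j+1)(j+2)w, but a
nilpotent T has no nonzero eigenvalue. -/
theorem raising_injective (j : ℕ) (w : D.W) (h : r.raising j w = 0) : w = 0 := by
  induction j generalizing w with
  | zero => exact r.onW_injective (h.trans (map_zero _).symm)
  | succ j ih =>
    have h2 : r.raising (j + 1) (D.J w) = 0 := by
      have h3 := r.actU_raising (j + 1) w
      rw [h, map_zero] at h3
      exact (smul_eq_zero.1 h3.symm).resolve_left (by positivity)
    have h4 := r.down_raising_succ j w
    rw [h, h2, Prod.mk_zero_zero, map_zero] at h4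
    have h5 := ih _ h4.symm
    obtain ⟨m, hm⟩ := D.T_nilpotent
    have ha : (2 * ((j + 1) * (j + 2)) : ℝ) ≠ 0 := by positivity
    refine eq_zero_of_nilpotent D.T ha m w (by rw [hm]; rfl) ?_
    rw [sub_eq_zero] at h5
    rw [mul_smul, ← h5, smul_smul]
    norm_num

theorem comparison_injective : Function.Injective (r.comparison) := by
  obtain ⟨π, h1, h2⟩ := exists_isotypic_projection _ M.isotypic_actU.2.1
  have h3 (v : D.Ind) : π 0 (r.comparison v) = r.onN v.1 := by
    induction v using Ind.induction with
    | hN n => rw [r.comparison_inN, h1 0 _ (r.onN_mem n)]; rfl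
    | hW j w => rw [r.comparison_inW, h2 0 _ _ (r.raising_mem j w) (by omega)]; simp
    | hadd v w hv hw => rw [map_add, map_add, hv, hw, add_fst, map_add]
  have h4 (j : ℕ) (v : D.Ind) :
      π (2 * (j + 1)) (r.comparison v) = r.raising j (v.2 j) := by
    induction v using Ind.induction with
    | hN n => rw [r.comparison_inN, h2 _ 0 _ (r.onN_mem n) (by omega)]; simp
    | hW i w =>
      rw [r.comparison_inW]
      by_cases hi : i = j
      · subst hi
        rw [h1 _ _ (r.raising_mem i w)]; simp
      · rw [h2 _ _ _ (r.raising_mem i w) (by omega)]; simp [hi]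
    | hadd v w hv hw => rw [map_add, map_add, hv, hw, add_snd, Finsupp.add_apply, map_add]
  rw [← LinearMap.ker_eq_bot, LinearMap.ker_eq_bot']
  intro v hv
  refine Ind.ext (r.onN_injective ?_) fun j => r.raising_injective j _ ?_
  · rw [← h3, hv, map_zero, zero_fst, map_zero]
  · rw [← h4, hv, map_zero]

/-- Raising after lowering is c/4 - (j+1)(j+2) on K-type 2(j+2), by `up_down`. It is surjective
there because c is nilpotent, and the lowered vectors are already reached by induction. -/
theorem exists_raising_eq (hM : isPrincipal M) (j : ℕ) (v : M.carrier)
    (hv : v ∈ isotypic (actU M.carrier) (2 * (j + 1))) : ∃ w, r.raising j w = v := by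
  induction j generalizing v with
  | zero => exact LinearMap.mem_range.1 (r.range_onW ▸ hv)
  | succ j ih =>
    have key (y : M.carrier) (hy : y ∈ isotypic (actU M.carrier) (2 * (j + 1 + 1))) :
        ∃ w, r.raising (j + 1) w =
          (1 / 4 : ℝ) • actC M.carrier y - ((j + 1) * (j + 2) : ℝ) • y := by
      -- The rotation of y by the complex structure u/m, where m = 2(j+2).
      let y' := (1 / (2 * (j + 2)) : ℝ) • actU M.carrier y
      have e1 : actU M.carrier y = (2 * (j + 2) : ℝ) • y' := by
        rw [smul_smul, mul_one_div_cancel (by positivity), one_smul]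
      have e2 : actU M.carrier y' = -(2 * (j + 2) : ℝ) • y := by
        rw [map_smul, mem_isotypic.1 hy, smul_smul]
        congr 1
        push_cast
        field_simp
        ring
      have d1 := actU_down e1 e2
      have d2 : actU M.carrier (down M.carrier (y', -y)) =
          -(2 * (j + 2) - 2 : ℝ) • down M.carrier (y, y') := by
        have e3 : actU M.carrier (-y) = -(2 * (j + 2) : ℝ) • y' := by rw [map_neg, e1, neg_smul]
        have e4 : actU M.carrier y' = (2 * (j + 2) : ℝ) • (-y) := by rw [e2, neg_smul, smul_neg]
        rw [actU_down e4 e3, ← Prod.neg_mk, map_neg, smul_neg, neg_smul]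
      obtain ⟨w, hw⟩ := ih (down M.carrier (y, y')) (by
        apply HCModule.mem_isotypic_of (v' := down M.carrier (y', -y))
        · rw [d1]; congr 1; push_cast; ring
        · rw [d2]; congr 1; push_cast; ring)
      have hw' : r.raising j (D.J w) = down M.carrier (y', -y) := by
        have h := r.actU_raising j w
        rw [hw, d1, show (2 * (j + 2) - 2 : ℝ) = 2 * (j + 1) by ring] at h
        exact (smul_right_injective _ (by positivity : (2 * (j + 1) : ℝ) ≠ 0) h).symm
      refine ⟨w, ?_⟩
      rw [r.raising_succ, hw, hw', up_down e1 e2]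
      congr 2
      ring
    obtain ⟨m, hm⟩ := hM.1
    have ha : (4 * ((j + 1) * (j + 2)) : ℝ) ≠ 0 := by positivity
    obtain ⟨z, hz, h⟩ := exists_sub_smul_eq (actC M.carrier) ha
      (isotypic (actU M.carrier) (2 * (j + 1 + 1))) (fun y hy => by
        rw [mem_isotypic] at hy ⊢
        rw [← actC_actU, ← actC_actU, hy, map_smul]) m v hv (by rw [actC_pow, hm])
    obtain ⟨w, hw⟩ := key z hz
    -- The equation was solved for c - 4(j+1)(j+2), which is 4 times the operator in `key`.
    refine ⟨(4 : ℝ) • w, ?_⟩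
    rw [map_smul, hw, ← h]
    module

theorem comparison_surjective (hM : isPrincipal M) : Function.Surjective (r.comparison) := by
  rw [← LinearMap.range_eq_top, eq_top_iff, ← M.isotypic_actU.2.1, iSup_le_iff]
  intro n v hv
  obtain ⟨k, rfl | rfl⟩ := Nat.even_or_odd' n
  · rcases k with _ | j
    · obtain ⟨w, rfl⟩ := LinearMap.mem_range.1 (r.range_onN ▸ hv)
      exact ⟨inN _ w, r.comparison_inN w⟩
    · obtain ⟨w, rfl⟩ := r.exists_raising_eq hM j v hv
      exact ⟨inW _ j w, r.comparison_inW j w⟩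
  · have h := M.isotypic_actU.1 _ v hv negOne
    rw [hM.2, chi_negOne] at h
    have h2 : v = -v := by simpa [pow_add, pow_mul] using h
    have h3 : (2 : ℝ) • v = 0 := by rw [two_smul, ← eq_neg_iff_add_eq_zero]; exact h2
    rw [(smul_eq_zero.1 h3).resolve_left two_ne_zero]
    exact zero_mem _

end Realization

namespace HCModule

/-- A bijective morphism is an isomorphism. -/
def isoOfBijective {M N : HCModule.{u}} (f : M ⟶ N) (hf : Function.Bijective f.1) : M ≅ N where
  hom := f
  inv := ⟨(LinearEquiv.ofBijective f.1 hf).symm.toLinearMap,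
    fun a v => hf.1 (by
      rw [f.2.1]
      change LinearEquiv.ofBijective f.1 hf ((LinearEquiv.ofBijective f.1 hf).symm (a • v)) =
        a • LinearEquiv.ofBijective f.1 hf ((LinearEquiv.ofBijective f.1 hf).symm v)
      rw [LinearEquiv.apply_symm_apply, LinearEquiv.apply_symm_apply]),
    fun k v => hf.1 (by
      rw [f.2.2]
      change LinearEquiv.ofBijective f.1 hf ((LinearEquiv.ofBijective f.1 hf).symm (N.ρ k v)) =
        N.ρ k (LinearEquiv.ofBijective f.1 hf ((LinearEquiv.ofBijective f.1 hf).symm v))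
      rw [LinearEquiv.apply_symm_apply, LinearEquiv.apply_symm_apply])⟩
  hom_inv_id := Subtype.ext (LinearMap.ext (LinearEquiv.ofBijective f.1 hf).symm_apply_apply)
  inv_hom_id := Subtype.ext (LinearMap.ext (LinearEquiv.ofBijective f.1 hf).apply_symm_apply)

end HCModule

/-! ### Essential surjectivity onto the principal block -/

namespace GelfandDatum

instance : toPrincipalBlock.{u}.EssSurj where
  mem_essImage M := ⟨M.obj.datum M.property, ⟨isPrincipal.isoMk (HCModule.isoOfBijective
    ⟨(HCModule.realization M.property).comparison, (HCModule.realization M.property).comparison_mem⟩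
    ⟨(HCModule.realization M.property).comparison_injective,
      (HCModule.realization M.property).comparison_surjective M.property⟩)⟩⟩

instance : toPrincipalBlock.{u}.IsEquivalence where

end GelfandDatum

/-! ## Power series acting through a nilpotent endomorphism -/

section

variable {V V' : Type*} [AddCommGroup V] [Module ℝ V] [AddCommGroup V'] [Module ℝ V']

/-- Truncation changes a polynomial by a multiple of Xⁿ, which x kills. This makes evaluation of
truncations multiplicative. -/
theorem aeval_trunc_coe {x : Module.End ℝ V} {n : ℕ} (hx : x ^ n = 0) (p : Polynomial ℝ) :
    Polynomial.aeval x (PowerSeries.trunc n (p : PowerSeries ℝ)) = Polynomial.aeval x p := by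
  obtain ⟨q, hq⟩ : Polynomial.X ^ n ∣ p - PowerSeries.trunc n (p : PowerSeries ℝ) := by
    rw [Polynomial.X_pow_dvd_iff]
    intro d hd
    rw [Polynomial.coeff_sub, PowerSeries.coeff_trunc, if_pos hd, Polynomial.coeff_coe, sub_self]
  have h := congrArg (Polynomial.aeval x) hq
  rw [map_sub, map_mul, map_pow, Polynomial.aeval_X, hx, zero_mul, sub_eq_zero] at h
  exact h.symm

/-- The evaluation of power series at a nilpotent endomorphism. -/
def evalNilpotent (x : Module.End ℝ V) (n : ℕ) (hx : x ^ n = 0) :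
    PowerSeries ℝ →+* Module.End ℝ V where
  toFun f := Polynomial.aeval x (PowerSeries.trunc n f)
  map_one' := by
    rw [← Polynomial.coe_one, aeval_trunc_coe hx, map_one]
  map_zero' := by rw [map_zero, map_zero]
  map_add' f g := by rw [map_add, map_add]
  map_mul' f g := by
    rw [← PowerSeries.trunc_trunc_mul_trunc, ← Polynomial.coe_mul, aeval_trunc_coe hx, map_mul]

theorem evalNilpotent_apply (x : Module.End ℝ V) (n : ℕ) (hx : x ^ n = 0) (f : PowerSeries ℝ) :
    evalNilpotent x n hx f = Polynomial.aeval x (PowerSeries.trunc n f) := rfl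

theorem evalNilpotent_X (x : Module.End ℝ V) (n : ℕ) (hx : x ^ n = 0) :
    evalNilpotent x n hx PowerSeries.X = x := by
  rw [evalNilpotent_apply, ← Polynomial.coe_X, aeval_trunc_coe hx, Polynomial.aeval_X]

theorem evalNilpotent_C (x : Module.End ℝ V) (n : ℕ) (hx : x ^ n = 0) (r : ℝ) (v : V) :
    evalNilpotent x n hx (PowerSeries.C r) v = r • v := by
  rw [evalNilpotent_apply, ← Polynomial.coe_C, aeval_trunc_coe hx, Polynomial.aeval_C]
  rfl

theorem map_aeval {x : Module.End ℝ V} {x' : Module.End ℝ V'} (g : V →ₗ[ℝ] V')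
    (hg : ∀ v, g (x v) = x' (g v)) (p : Polynomial ℝ) (v : V) :
    g (Polynomial.aeval x p v) = Polynomial.aeval x' p (g v) := by
  induction p using Polynomial.induction_on' with
  | add p q hp hq => simp [hp, hq]
  | monomial n r =>
    have h (n : ℕ) (v : V) : g ((x ^ n) v) = (x' ^ n) (g v) := by
      induction n generalizing v with
      | zero => rfl
      | succ n ih => rw [pow_succ, Module.End.mul_apply, ih, hg, pow_succ]; rfl
    simp [Polynomial.aeval_monomial, h]

end

/-! ## The module of a Gelfand datum over the Gelfand order -/

namespace GelfandDatum

variable (D : GelfandDatum.{u})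

/-- With one exponent for W and N0 a power series acts on both through the same polynomial, so
`map_aeval` makes P and Q linear over power series. -/
theorem exists_common_nilpotency : ∃ n : ℕ, D.T ^ n = 0 ∧ (D.Q ∘ₗ D.P) ^ n = 0 := by
  obtain ⟨a, ha⟩ := D.T_nilpotent
  obtain ⟨b, hb⟩ := D.nilpotent
  refine ⟨a + b, by rw [pow_add, ha, zero_mul], ?_⟩
  rw [pow_add, show (D.Q ∘ₗ D.P) ^ b = 0 from LinearMap.ext hb, mul_zero]

instance moduleSeriesW : Module (PowerSeries ℝ) D.W :=
  Module.compHom D.W (evalNilpotent D.T _ D.exists_common_nilpotency.choose_spec.1)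

instance moduleSeriesN0 : Module (PowerSeries ℝ) D.N0 :=
  Module.compHom D.N0 (evalNilpotent (D.Q ∘ₗ D.P) _ D.exists_common_nilpotency.choose_spec.2)

theorem X_smul_W (w : D.W) : (PowerSeries.X : PowerSeries ℝ) • w = D.T w :=
  LinearMap.congr_fun (evalNilpotent_X D.T _ D.exists_common_nilpotency.choose_spec.1) w

theorem X_smul_N0 (n : D.N0) : (PowerSeries.X : PowerSeries ℝ) • n = D.Q (D.P n) :=
  LinearMap.congr_fun (evalNilpotent_X (D.Q ∘ₗ D.P) _ D.exists_common_nilpotency.choose_spec.2) n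

theorem C_smul_W (r : ℝ) (w : D.W) : (PowerSeries.C r : PowerSeries ℝ) • w = r • w :=
  evalNilpotent_C D.T _ D.exists_common_nilpotency.choose_spec.1 r w

theorem C_smul_N0 (r : ℝ) (n : D.N0) : (PowerSeries.C r : PowerSeries ℝ) • n = r • n :=
  evalNilpotent_C (D.Q ∘ₗ D.P) _ D.exists_common_nilpotency.choose_spec.2 r n

/-- The map `J` as a map of modules over the power series. -/
def seriesJ : D.W →ₗ[PowerSeries ℝ] D.W where
  toFun := D.J
  map_add' := map_add D.J
  map_smul' _ w := map_aeval D.J (fun w => (D.T_J w).symm) _ w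

/-- The map `P` as a map of modules over the power series. -/
def seriesP : D.N0 →ₗ[PowerSeries ℝ] D.W where
  toFun := D.P
  map_add' := map_add D.P
  map_smul' _ w := map_aeval D.P (fun n => (D.T_P n).symm) _ w

/-- The map `Q` as a map of modules over the power series. -/
def seriesQ : D.W →ₗ[PowerSeries ℝ] D.N0 where
  toFun := D.Q
  map_add' := map_add D.Q
  map_smul' _ w := map_aeval D.Q D.Q_T _ w

end GelfandDatum

/-- The action of a matrix in the Gelfand order on a pair `(w, n)` in terms of its coordinates. -/
def coordAction {R W N : Type*} [CommRing R] [AddCommGroup W] [AddCommGroup N] [Module R W]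
    [Module R N] (J : W →ₗ[R] W) (P : N →ₗ[R] W) (Q : W →ₗ[R] N) (α β c d p r x y z : R) :
    W × N →ₗ[R] W × N :=
  LinearMap.prod
    ((α • LinearMap.id + β • J - c • J ∘ₗ P ∘ₗ Q - d • J ∘ₗ P ∘ₗ Q ∘ₗ J).coprod
      (p • P - r • J ∘ₗ P))
    ((x • Q + y • Q ∘ₗ J).coprod (z • LinearMap.id))

theorem coordAction_fst {R W N : Type*} [CommRing R] [AddCommGroup W] [AddCommGroup N] [Module R W]
    [Module R N] (J : W →ₗ[R] W) (P : N →ₗ[R] W) (Q : W →ₗ[R] N) (α β c d p r x y z : R)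
    (v : W × N) : (coordAction J P Q α β c d p r x y z v).1 =
      α • v.1 + β • J v.1 - c • J (P (Q v.1)) - d • J (P (Q (J v.1))) +
        (p • P v.2 - r • J (P v.2)) := rfl

theorem coordAction_snd {R W N : Type*} [CommRing R] [AddCommGroup W] [AddCommGroup N] [Module R W]
    [Module R N] (J : W →ₗ[R] W) (P : N →ₗ[R] W) (Q : W →ₗ[R] N) (α β c d p r x y z : R)
    (v : W × N) : (coordAction J P Q α β c d p r x y z v).2 =
      x • Q v.1 + y • Q (J v.1) + z • v.2 := rfl

/-- The hypothesis `hT` says that TJ = tJ, so words in J, P, Q reduce to finitely many. The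
coefficients on the right are those of a matrix product, in the coordinates a₁₀ = -a₀₁ + tc, a₁₁ =
a₀₀ + td, a₀₂ = tp, a₁₂ = tr. -/
theorem coordAction_comp {R W N : Type*} [CommRing R] [AddCommGroup W] [AddCommGroup N]
    [Module R W] [Module R N] (J : W →ₗ[R] W) (P : N →ₗ[R] W) (Q : W →ₗ[R] N) (t : R)
    (hJ : ∀ w, J (J w) = -w) (hQJP : ∀ n, Q (J (P n)) = 0) (hQP : ∀ n, Q (P n) = t • n)
    (hT : ∀ w, J (P (Q w)) = t • J w - P (Q (J w)))
    (α β c d p r x y z α' β' c' d' p' r' x' y' z' : R) (v : W × N) :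
    coordAction J P Q α β c d p r x y z (coordAction J P Q α' β' c' d' p' r' x' y' z' v) =
      coordAction J P Q (α * α' + β * (-β' + t * c') + t * p * x')
        (α * β' + β * (α' + t * d') + t * p * y')
        (c * α' + α * c' - d * β' + t * d * c' + r * x' + β * d' + p * y')
        (c * β' + α * d' + d * α' + t * d * d' + r * y' - β * c' - p * x')
        (α * p' + β * r' + p * z')
        (-β * p' + t * c * p' + α * r' + t * d * r' + r * z')
        (x * α' + y * (-β' + t * c') + z * x')
        (x * β' + y * (α' + t * d') + z * y')
        (t * x * p' + t * y * r' + z * z') v := by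
  refine Prod.ext ?_ ?_
  · simp only [coordAction_fst, coordAction_snd, map_add, map_sub, map_smul, map_neg, hJ, hQJP, hQP,
      map_zero, hT]
    module
  · simp only [coordAction_fst, coordAction_snd, map_add, map_sub, map_smul, map_neg, hJ, hQJP, hQP,
      hT]
    module

/-! ## Coordinates and generators of the Gelfand order -/

/-- The power series `f` without its constant term, divided by `X`. -/
def shift : PowerSeries ℝ →ₗ[ℝ] PowerSeries ℝ where
  toFun f := PowerSeries.mk fun n => PowerSeries.coeff (n + 1) f
  map_add' f g := by ext n; simp
  map_smul' r f := by ext n; simp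

theorem X_mul_shift {f : PowerSeries ℝ} (h : PowerSeries.constantCoeff f = 0) :
    PowerSeries.X * shift f = f := by
  conv_rhs => rw [PowerSeries.eq_X_mul_shift_add_const f, h, map_zero, add_zero]
  rfl

theorem shift_X_mul (f : PowerSeries ℝ) : shift (PowerSeries.X * f) = f := by
  ext n
  simp [shift, PowerSeries.coeff_succ_X_mul]

theorem shift_eq {f g : PowerSeries ℝ} (h : f = PowerSeries.X * g) : shift f = g := by
  rw [h, shift_X_mul]

namespace gelfandOrder

variable (a b : gelfandOrder)

/-- The coordinate of `a` with `a₁₀ = - a₀₁ + X * coordC a`. -/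
def coordC : PowerSeries ℝ := shift (a.1 1 0 + a.1 0 1)

/-- The coordinate of `a` with `a₁₁ = a₀₀ + X * coordD a`. -/
def coordD : PowerSeries ℝ := shift (a.1 1 1 - a.1 0 0)

/-- The coordinate of `a` with `a₀₂ = X * coordP a`. -/
def coordP : PowerSeries ℝ := shift (a.1 0 2)

/-- The coordinate of `a` with `a₁₂ = X * coordR a`. -/
def coordR : PowerSeries ℝ := shift (a.1 1 2)

theorem apply_one_zero : a.1 1 0 = -a.1 0 1 + PowerSeries.X * coordC a := by
  rw [coordC, X_mul_shift (by rw [map_add, a.2.2.2.2, neg_add_cancel])]; ring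

theorem apply_one_one : a.1 1 1 = a.1 0 0 + PowerSeries.X * coordD a := by
  rw [coordD, X_mul_shift (by rw [map_sub, a.2.2.2.1, sub_self])]; ring

theorem apply_zero_two : a.1 0 2 = PowerSeries.X * coordP a := by
  rw [coordP, X_mul_shift a.2.1]

theorem apply_one_two : a.1 1 2 = PowerSeries.X * coordR a := by
  rw [coordR, X_mul_shift a.2.2.1]

theorem mul_entry (i j : Fin 3) :
    (a * b).1 i j = a.1 i 0 * b.1 0 j + a.1 i 1 * b.1 1 j + a.1 i 2 * b.1 2 j := by
  change (a.1 * b.1) i j = _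
  rw [Matrix.mul_apply, Fin.sum_univ_three]

/-- The scalar matrices in the Gelfand order. -/
def scal : PowerSeries ℝ →ₐ[ℝ] gelfandOrder :=
  ((Algebra.ofId (PowerSeries ℝ) (Matrix (Fin 3) (Fin 3) (PowerSeries ℝ))).restrictScalars
    ℝ).codRestrict gelfandOrder fun f => by
      refine ⟨?_, ?_, ?_, ?_⟩ <;> simp [Algebra.ofId_apply, Matrix.algebraMap_matrix_apply]

theorem coe_scal (f : PowerSeries ℝ) : (scal f).1 = !![f, 0, 0; 0, f, 0; 0, 0, f] := by
  ext1 i j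
  change algebraMap (PowerSeries ℝ) (Matrix (Fin 3) (Fin 3) (PowerSeries ℝ)) f i j = _
  fin_cases i <;> fin_cases j <;> simp [Matrix.algebraMap_matrix_apply]

/-- The idempotent `E₂₂`. -/
def genE : gelfandOrder := ⟨!![0, 0, 0; 0, 0, 0; 0, 0, 1], by refine ⟨?_, ?_, ?_, ?_⟩ <;> simp⟩

/-- The complex structure `E₀₁ - E₁₀`. -/
def genJ : gelfandOrder := ⟨!![0, 1, 0; -1, 0, 0; 0, 0, 0], by refine ⟨?_, ?_, ?_, ?_⟩ <;> simp⟩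

/-- The element `X E₀₂`. -/
def genP : gelfandOrder :=
  ⟨!![0, 0, PowerSeries.X; 0, 0, 0; 0, 0, 0], by refine ⟨?_, ?_, ?_, ?_⟩ <;> simp⟩

/-- The element `E₂₀`. -/
def genQ : gelfandOrder := ⟨!![0, 0, 0; 0, 0, 0; 1, 0, 0], by refine ⟨?_, ?_, ?_, ?_⟩ <;> simp⟩

theorem ext_entries {a b : gelfandOrder} (h : ∀ i j, a.1 i j = b.1 i j) : a = b :=
  Subtype.ext (Matrix.ext h)

theorem genE_mul_genE : genE * genE = genE :=
  ext_entries fun i j => by fin_cases i <;> fin_cases j <;> simp [genE]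

theorem genE_mul_genJ : genE * genJ = 0 :=
  ext_entries fun i j => by fin_cases i <;> fin_cases j <;> simp [genE, genJ]

theorem genJ_mul_genE : genJ * genE = 0 :=
  ext_entries fun i j => by fin_cases i <;> fin_cases j <;> simp [genE, genJ]

theorem genE_mul_genP : genE * genP = 0 :=
  ext_entries fun i j => by fin_cases i <;> fin_cases j <;> simp [genE, genP]

theorem genP_mul_genE : genP * genE = genP :=
  ext_entries fun i j => by fin_cases i <;> fin_cases j <;> simp [genE, genP]

theorem genE_mul_genQ : genE * genQ = genQ :=
  ext_entries fun i j => by fin_cases i <;> fin_cases j <;> simp [genE, genQ]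

theorem genQ_mul_genE : genQ * genE = 0 :=
  ext_entries fun i j => by fin_cases i <;> fin_cases j <;> simp [genE, genQ]

theorem genJ_mul_genJ : genJ * genJ = genE - 1 :=
  ext_entries fun i j => by fin_cases i <;> fin_cases j <;> simp [genE, genJ]

theorem genQ_mul_genJ_mul_genP : genQ * (genJ * genP) = 0 :=
  ext_entries fun i j => by fin_cases i <;> fin_cases j <;> simp [genQ, genJ, genP]

theorem genQ_mul_genP : genQ * genP = scal PowerSeries.X * genE :=
  ext_entries fun i j => by
    fin_cases i <;> fin_cases j <;> simp [genQ, genP, genE, coe_scal]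

/-- The three summands PQ, -JPQJ and QP are X times the diagonal idempotents. Hence X is T on W and
QP on N0. -/
theorem scal_X : scal PowerSeries.X =
    genP * genQ - genJ * (genP * (genQ * genJ)) + genQ * genP :=
  ext_entries fun i j => by
    fin_cases i <;> fin_cases j <;> simp [genQ, genP, genJ, coe_scal]

/-- The products JPQ, JPQJ and JP are -X E₁₀, -X E₁₁ and -X E₁₂, which accounts for the signs. -/
theorem eq_coord : a = scal (a.1 0 0) * (1 - genE) + scal (a.1 0 1) * genJ
    - scal (coordC a) * (genJ * (genP * genQ))
    - scal (coordD a) * (genJ * (genP * (genQ * genJ)))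
    + scal (coordP a) * genP - scal (coordR a) * (genJ * genP)
    + scal (a.1 2 0) * genQ + scal (a.1 2 1) * (genQ * genJ) + scal (a.1 2 2) * genE := by
  have h1 := apply_one_zero a
  have h2 := apply_one_one a
  have h3 := apply_zero_two a
  have h4 := apply_one_two a
  refine ext_entries fun i j => ?_
  fin_cases i <;> fin_cases j <;> simp [genE, genQ, genP, genJ, coe_scal, h1, h2, h3, h4, mul_comm,
    mul_sub]

theorem coordC_mul : coordC (a * b) = coordC a * b.1 0 0 + a.1 0 0 * coordC b -
    coordD a * b.1 0 1 + PowerSeries.X * coordD a * coordC b + coordR a * b.1 2 0 +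
    a.1 0 1 * coordD b + coordP a * b.1 2 1 := by
  refine shift_eq ?_
  simp only [mul_entry, apply_one_zero, apply_one_one, apply_zero_two, apply_one_two]
  ring

theorem coordD_mul : coordD (a * b) = coordC a * b.1 0 1 + a.1 0 0 * coordD b +
    coordD a * b.1 0 0 + PowerSeries.X * coordD a * coordD b + coordR a * b.1 2 1 -
    a.1 0 1 * coordC b - coordP a * b.1 2 0 := by
  refine shift_eq ?_
  simp only [mul_entry, apply_one_zero, apply_one_one, apply_zero_two, apply_one_two]
  ring

theorem coordP_mul : coordP (a * b) =
    a.1 0 0 * coordP b + a.1 0 1 * coordR b + coordP a * b.1 2 2 := by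
  refine shift_eq ?_
  simp only [mul_entry, apply_zero_two, apply_one_two]
  ring

theorem coordR_mul : coordR (a * b) = -a.1 0 1 * coordP b +
    PowerSeries.X * coordC a * coordP b + a.1 0 0 * coordR b +
    PowerSeries.X * coordD a * coordR b + coordR a * b.1 2 2 := by
  refine shift_eq ?_
  simp only [mul_entry, apply_one_zero, apply_one_one, apply_zero_two, apply_one_two]
  ring

end gelfandOrder

/-! ## Finite-dimensional modules over the Gelfand order -/

section

open gelfandOrder

variable {N N' : Type*} [AddCommGroup N] [AddCommGroup N'] [Module ℝ N] [Module ℝ N']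
  [Module gelfandOrder N] [Module gelfandOrder N'] [IsScalarTower ℝ gelfandOrder N]
  [IsScalarTower ℝ gelfandOrder N']

variable (N) in
-- The minimal polynomial of the action of X, viewed as a power series, is a unit times some Xⁿ. As
-- it acts by zero, so does Xⁿ.
theorem exists_scal_X_pow_smul [FiniteDimensional ℝ N] :
    ∃ n : ℕ, ∀ v : N, scal (PowerSeries.X ^ n) • v = 0 := by
  let φ : PowerSeries ℝ →ₐ[ℝ] Module.End ℝ N := (Algebra.lsmul ℝ ℝ N).comp scal
  have hφ (p : Polynomial ℝ) : Polynomial.aeval (φ PowerSeries.X) p = φ p := by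
    have : Polynomial.aeval (φ PowerSeries.X) =
        φ.comp (Polynomial.coeToPowerSeries.algHom ℝ) := by
      apply Polynomial.algHom_ext
      simp [Polynomial.coeToPowerSeries.algHom_apply]
    rw [this]
    simp [Polynomial.coeToPowerSeries.algHom_apply]
  have hint : IsIntegral ℝ (φ PowerSeries.X) := Algebra.IsIntegral.isIntegral _
  have h0 : φ (minpoly ℝ (φ PowerSeries.X)) = 0 := by rw [← hφ, minpoly.aeval]
  have hne : ((minpoly ℝ (φ PowerSeries.X) : Polynomial ℝ) : PowerSeries ℝ) ≠ 0 := by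
    rw [Ne, Polynomial.coe_eq_zero_iff]
    exact minpoly.ne_zero hint
  obtain ⟨n, w, hw⟩ := IsDiscreteValuationRing.eq_unit_mul_pow_irreducible hne
    PowerSeries.X_irreducible
  rw [hw, map_mul] at h0
  have h1 : φ (PowerSeries.X ^ n) = 0 := by
    have h2 := congrArg (fun z => φ (w⁻¹ : (PowerSeries ℝ)ˣ) * z) h0
    rwa [← mul_assoc, ← map_mul, Units.inv_mul, map_one, one_mul, mul_zero] at h2
  exact ⟨n, fun v => LinearMap.congr_fun h1 v⟩

/-- The four elements generate X, hence all polynomial scalars. A high power of X kills both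
modules, so on them every power series acts as a truncation, and `eq_coord` supplies the rest. -/
theorem map_smul_of_generators [FiniteDimensional ℝ N] [FiniteDimensional ℝ N'] (f : N →ₗ[ℝ] N')
    (hE : ∀ v, f (genE • v) = genE • f v) (hJ : ∀ v, f (genJ • v) = genJ • f v)
    (hP : ∀ v, f (genP • v) = genP • f v) (hQ : ∀ v, f (genQ • v) = genQ • f v)
    (a : gelfandOrder) (v : N) : f (a • v) = a • f v := by
  let S : Subalgebra ℝ gelfandOrder :=
    { carrier := {a | ∀ v, f (a • v) = a • f v}
      mul_mem' := fun {a b} ha hb v => by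
        rw [mul_smul, ha, hb, mul_smul]
      add_mem' := fun {a b} ha hb v => by
        rw [add_smul, map_add, ha, hb, add_smul]
      algebraMap_mem' := fun r v => by
        rw [algebraMap_smul, algebraMap_smul, map_smul] }
  have sE : genE ∈ S := hE
  have sJ : genJ ∈ S := hJ
  have sP : genP ∈ S := hP
  have sQ : genQ ∈ S := hQ
  have sX : scal PowerSeries.X ∈ S := by
    rw [scal_X]
    exact S.add_mem (S.sub_mem (S.mul_mem sP sQ)
      (S.mul_mem sJ (S.mul_mem sP (S.mul_mem sQ sJ)))) (S.mul_mem sQ sP)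
  have spoly (p : Polynomial ℝ) : scal (p : PowerSeries ℝ) ∈ S := by
    induction p using Polynomial.induction_on' with
    | add p q hp hq => rw [Polynomial.coe_add, map_add]; exact S.add_mem hp hq
    | monomial n r =>
      rw [← Polynomial.smul_X_eq_monomial, Polynomial.coe_smul, map_smul, Polynomial.coe_pow,
        Polynomial.coe_X, map_pow]
      exact S.smul_mem (S.pow_mem sX n) r
  obtain ⟨m, hm⟩ := exists_scal_X_pow_smul N
  obtain ⟨m', hm'⟩ := exists_scal_X_pow_smul N'
  have sscal (g : PowerSeries ℝ) : scal g ∈ S := by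
    intro v
    obtain ⟨q, hq⟩ : PowerSeries.X ^ (m + m') ∣
        g - (PowerSeries.trunc (m + m') g : PowerSeries ℝ) := by
      rw [PowerSeries.X_pow_dvd_iff]
      intro d hd
      rw [map_sub, Polynomial.coeff_coe, PowerSeries.coeff_trunc, if_pos hd, sub_self]
    rw [sub_eq_iff_eq_add] at hq
    have h1 : scal g • v = scal (PowerSeries.trunc (m + m') g : PowerSeries ℝ) • v := by
      conv_lhs => rw [hq]
      rw [map_add, add_smul, pow_add, mul_assoc, map_mul, mul_smul, hm, zero_add]
    have h2 : scal g • f v = scal (PowerSeries.trunc (m + m') g : PowerSeries ℝ) • f v := by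
      conv_lhs => rw [hq]
      rw [map_add, add_smul, pow_add, mul_comm (_ ^ m), mul_assoc, map_mul, mul_smul, hm', zero_add]
    rw [h1, h2]
    exact spoly _ v
  have sa : a ∈ S := by
    rw [eq_coord a]
    have h1 := S.sub_mem S.one_mem sE
    have h2 := S.mul_mem sJ (S.mul_mem sP sQ)
    have h3 := S.mul_mem sJ (S.mul_mem sP (S.mul_mem sQ sJ))
    have h4 := S.mul_mem sJ sP
    have h5 := S.mul_mem sQ sJ
    exact S.add_mem (S.add_mem (S.add_mem (S.sub_mem (S.add_mem (S.sub_mem (S.sub_mem (S.add_mem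
      (S.mul_mem (sscal _) h1) (S.mul_mem (sscal _) sJ)) (S.mul_mem (sscal _) h2))
      (S.mul_mem (sscal _) h3)) (S.mul_mem (sscal _) sP)) (S.mul_mem (sscal _) h4))
      (S.mul_mem (sscal _) sQ)) (S.mul_mem (sscal _) h5)) (S.mul_mem (sscal _) sE)
  exact sa v

end

/-! ### The functor from Gelfand data to `RepA` -/

namespace GelfandDatum

open gelfandOrder

/-- The space `W ⊕ N0` as a module over the Gelfand order. -/
def OrderModule (D : GelfandDatum.{u}) : Type u := D.W × D.N0

namespace OrderModule

variable {D E : GelfandDatum.{u}}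

instance : AddCommGroup D.OrderModule := inferInstanceAs (AddCommGroup (D.W × D.N0))

instance : Module ℝ D.OrderModule := inferInstanceAs (Module ℝ (D.W × D.N0))

instance : FiniteDimensional ℝ D.OrderModule :=
  inferInstanceAs (FiniteDimensional ℝ (D.W × D.N0))

variable (D) in
/-- The action of a matrix on `W ⊕ N0`. -/
def matrixAction (a : gelfandOrder) : (D.W × D.N0) →ₗ[PowerSeries ℝ] (D.W × D.N0) :=
  coordAction D.seriesJ D.seriesP D.seriesQ (a.1 0 0) (a.1 0 1) (coordC a) (coordD a) (coordP a)
    (coordR a) (a.1 2 0) (a.1 2 1) (a.1 2 2)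

theorem matrixAction_mul (a b : gelfandOrder) (v : D.W × D.N0) :
    matrixAction D (a * b) v = matrixAction D a (matrixAction D b v) := by
  have hT (w : D.W) : D.seriesJ (D.seriesP (D.seriesQ w)) =
      (PowerSeries.X : PowerSeries ℝ) • D.seriesJ w - D.seriesP (D.seriesQ (D.seriesJ w)) := by
    rw [D.X_smul_W]
    change D.J (D.P (D.Q w)) = D.T (D.J w) - D.P (D.Q (D.J w))
    simp [D.T_apply]
  rw [matrixAction, matrixAction, matrixAction, coordAction_comp _ _ _ PowerSeries.X D.J_J D.Q_J_P
    (fun n => (D.X_smul_N0 n).symm) hT, coordC_mul, coordD_mul, coordP_mul, coordR_mul]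
  simp only [mul_entry, apply_one_zero, apply_one_one, apply_zero_two, apply_one_two]
  congr 2
  all_goals ring

theorem matrixAction_add (a b : gelfandOrder) (v : D.W × D.N0) :
    matrixAction D (a + b) v = matrixAction D a v + matrixAction D b v := by
  have h (i j : Fin 3) : (a + b).1 i j = a.1 i j + b.1 i j := rfl
  have hC : coordC (a + b) = coordC a + coordC b := by
    simp only [coordC, h, ← map_add]; congr 1; ring
  have hD : coordD (a + b) = coordD a + coordD b := by
    simp only [coordD, h, ← map_add]; congr 1; ring
  have hP : coordP (a + b) = coordP a + coordP b := by simp only [coordP, h, map_add]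
  have hR : coordR (a + b) = coordR a + coordR b := by simp only [coordR, h, map_add]
  refine Prod.ext ?_ ?_
  · simp only [matrixAction, coordAction_fst, hC, hD, hP, hR, h, Prod.fst_add,
      add_smul]
    abel
  · simp only [matrixAction, coordAction_snd, h, Prod.snd_add, add_smul]
    abel

theorem matrixAction_algebraMap (r : ℝ) (v : D.W × D.N0) :
    matrixAction D (algebraMap ℝ gelfandOrder r) v = r • v := by
  have h (i j : Fin 3) : (algebraMap ℝ gelfandOrder r).1 i j =
      if i = j then PowerSeries.C r else 0 := by
    change algebraMap ℝ (Matrix (Fin 3) (Fin 3) (PowerSeries ℝ)) r i j = _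
    rw [Matrix.algebraMap_matrix_apply]
    rfl
  refine Prod.ext ?_ ?_
  · simp [matrixAction, coordAction_fst, coordC, coordD, coordP, coordR, h, C_smul_W]
  · simp [matrixAction, coordAction_snd, h, C_smul_N0]

theorem matrixAction_one (v : D.W × D.N0) : matrixAction D 1 v = v := by
  rw [← map_one (algebraMap ℝ gelfandOrder), matrixAction_algebraMap, one_smul]

theorem matrixAction_zero (v : D.W × D.N0) : matrixAction D 0 v = 0 := by
  rw [← map_zero (algebraMap ℝ gelfandOrder), matrixAction_algebraMap, zero_smul]

theorem shift_X : shift PowerSeries.X = 1 := shift_eq (mul_one _).symm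

theorem matrixAction_genE (v : D.W × D.N0) : matrixAction D genE v = (0, v.2) := by
  refine Prod.ext ?_ ?_
  · simp [matrixAction, coordAction_fst, coordC, coordD, coordP, coordR, genE]
  · simp [matrixAction, coordAction_snd, genE]

theorem matrixAction_genJ (v : D.W × D.N0) : matrixAction D genJ v = (D.J v.1, 0) := by
  refine Prod.ext ?_ ?_
  · simp [matrixAction, coordAction_fst, coordC, coordD, coordP, coordR, genJ]
    rfl
  · simp [matrixAction, coordAction_snd, genJ]

theorem matrixAction_genP (v : D.W × D.N0) : matrixAction D genP v = (D.P v.2, 0) := by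
  refine Prod.ext ?_ ?_
  · simp [matrixAction, coordAction_fst, coordC, coordD, coordP, coordR, genP, shift_X]
    rfl
  · simp [matrixAction, coordAction_snd, genP]

theorem matrixAction_genQ (v : D.W × D.N0) : matrixAction D genQ v = (0, D.Q v.1) := by
  refine Prod.ext ?_ ?_
  · simp [matrixAction, coordAction_fst, coordC, coordD, coordP, coordR, genQ]
  · simp [matrixAction, coordAction_snd, genQ]
    rfl

instance : Module gelfandOrder D.OrderModule where
  smul a v := matrixAction D a v
  one_smul := matrixAction_one
  mul_smul := matrixAction_mul
  smul_zero a := map_zero (matrixAction D a)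
  smul_add a := map_add (matrixAction D a)
  add_smul := matrixAction_add
  zero_smul := matrixAction_zero

instance : IsScalarTower ℝ gelfandOrder D.OrderModule where
  smul_assoc r a (v : D.W × D.N0) := by
    change matrixAction D (r • a) v = r • matrixAction D a v
    rw [Algebra.smul_def, matrixAction_mul, matrixAction_algebraMap]

theorem genE_smul (v : D.OrderModule) : genE • v = ((0, v.2) : D.W × D.N0) :=
  matrixAction_genE v

theorem genJ_smul (v : D.OrderModule) : genJ • v = ((D.J v.1, 0) : D.W × D.N0) :=
  matrixAction_genJ v

theorem genP_smul (v : D.OrderModule) : genP • v = ((D.P v.2, 0) : D.W × D.N0) :=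
  matrixAction_genP v

theorem genQ_smul (v : D.OrderModule) : genQ • v = ((0, D.Q v.1) : D.W × D.N0) :=
  matrixAction_genQ v

variable (D) in
/-- The inclusion of `W`. -/
def inW : D.W →ₗ[ℝ] D.OrderModule := LinearMap.inl ℝ D.W D.N0

variable (D) in
/-- The inclusion of `N0`. -/
def inN : D.N0 →ₗ[ℝ] D.OrderModule := LinearMap.inr ℝ D.W D.N0

variable (D) in
/-- The projection to `W`. -/
def toW : D.OrderModule →ₗ[ℝ] D.W := LinearMap.fst ℝ D.W D.N0

variable (D) in
/-- The projection to `N0`. -/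
def toN : D.OrderModule →ₗ[ℝ] D.N0 := LinearMap.snd ℝ D.W D.N0

/-- The linear map induced by a morphism of Gelfand data. -/
def mapReal (f : D ⟶ E) : D.OrderModule →ₗ[ℝ] E.OrderModule := f.1.2.prodMap f.1.1

/-- The map of modules over the Gelfand order that is induced by a morphism of Gelfand data. -/
def map (f : D ⟶ E) : D.OrderModule →ₗ[gelfandOrder] E.OrderModule where
  toFun := mapReal f
  map_add' := map_add (mapReal f)
  map_smul' := map_smul_of_generators (mapReal f)
    (fun v => by
      rw [genE_smul, genE_smul]
      exact Prod.ext (map_zero f.1.2) rfl)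
    (fun v => by
      rw [genJ_smul, genJ_smul]
      exact Prod.ext (f.2.1 _) (map_zero f.1.1))
    (fun v => by
      rw [genP_smul, genP_smul]
      exact Prod.ext (f.2.2.1 _) (map_zero f.1.1))
    (fun v => by
      rw [genQ_smul, genQ_smul]
      exact Prod.ext (map_zero f.1.2) (f.2.2.2 _))

/-- Commuting with the idempotent `genE` makes `g` block diagonal; the other generators give the
conditions on its two blocks. -/
theorem exists_map_eq (g : D.OrderModule →ₗ[gelfandOrder] E.OrderModule) :
    ∃ f : D ⟶ E, map f = g := by
  let g' : D.OrderModule →ₗ[ℝ] E.OrderModule := g.restrictScalars ℝ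
  have hE (v : D.OrderModule) : g' ((0, v.2) : D.W × D.N0) = ((0, (g' v).2) : E.W × E.N0) := by
    rw [← genE_smul, ← genE_smul]; exact map_smul g _ _
  have hJ (v : D.OrderModule) : g' ((D.J v.1, 0) : D.W × D.N0) =
      ((E.J (g' v).1, 0) : E.W × E.N0) := by
    rw [← genJ_smul, ← genJ_smul]; exact map_smul g _ _
  have hP (v : D.OrderModule) : g' ((D.P v.2, 0) : D.W × D.N0) =
      ((E.P (g' v).2, 0) : E.W × E.N0) := by
    rw [← genP_smul, ← genP_smul]; exact map_smul g _ _
  have hQ (v : D.OrderModule) : g' ((0, D.Q v.1) : D.W × D.N0) =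
      ((0, E.Q (g' v).1) : E.W × E.N0) := by
    rw [← genQ_smul, ← genQ_smul]; exact map_smul g _ _
  refine ⟨⟨(toN E ∘ₗ g' ∘ₗ inN D, toW E ∘ₗ g' ∘ₗ inW D), fun w => ?_, fun n => ?_, fun w => ?_⟩,
    LinearMap.ext fun v => ?_⟩
  · exact congrArg Prod.fst (hJ (inW D w))
  · exact congrArg Prod.fst (hP (inN D n))
  · exact congrArg Prod.snd (hQ (inW D w))
  · have h1 : g' (inN D (toN D v)) = ((0, (g' v).2) : E.W × E.N0) := hE v
    have h2 : (g' (inW D (toW D v))).2 = (0 : E.N0) :=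
      (congrArg Prod.snd ((hE (inW D (toW D v))).symm.trans (map_zero g')) :)
    have h3 : v = inW D (toW D v) + inN D (toN D v) :=
      Prod.ext (add_zero _).symm (zero_add _).symm
    have h4 : g' v = g' (inW D (toW D v)) + g' (inN D (toN D v)) := by
      rw [← map_add, ← h3]
    refine Prod.ext ?_ ?_
    · change (g' (inW D (toW D v))).1 = (g' v).1
      rw [h4, h1]
      exact (add_zero _).symm
    · change (g' (inN D (toN D v))).2 = (g' v).2
      rw [h1]

end OrderModule

/-- The definition of `RepA` uses the real structure restricted along ℝ → A; the scalar tower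
identifies it with the given one. -/
theorem isFiniteDimensional_of (V : Type u) [AddCommGroup V] [inst : Module ℝ V]
    [Module gelfandOrder V] [IsScalarTower ℝ gelfandOrder V] [hV : FiniteDimensional ℝ V] :
    isFiniteDimensional (ModuleCat.of gelfandOrder V) := by
  have h : Module.restrictScalars ℝ gelfandOrder V = inst :=
    Module.ext' _ _ fun r v => algebraMap_smul gelfandOrder r v
  change @Module.Finite ℝ V _ _ (Module.restrictScalars ℝ gelfandOrder V)
  rw [h]
  exact hV

/-- The functor from Gelfand data to the finite-dimensional modules over the Gelfand order. -/
def toRepA : GelfandDatum.{u} ⥤ RepA.{u} where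
  obj D := ⟨ModuleCat.of gelfandOrder D.OrderModule, isFiniteDimensional_of D.OrderModule⟩
  map f := ObjectProperty.homMk (ModuleCat.ofHom (OrderModule.map f))
  map_id D := by
    apply ObjectProperty.hom_ext
    rfl
  map_comp f g := by
    apply ObjectProperty.hom_ext
    rfl

instance : toRepA.{u}.Additive where
  map_add {D E f g} := by
    apply ObjectProperty.hom_ext
    rfl

instance : toRepA.{u}.Linear ℝ where
  map_smul {D E} f r := by
    apply ObjectProperty.hom_ext
    apply ModuleCat.hom_ext
    refine LinearMap.ext fun v => ?_
    exact (algebraMap_smul gelfandOrder r (OrderModule.map f v)).symm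

instance : toRepA.{u}.Faithful where
  map_injective {D E f g} h := by
    have h2 : OrderModule.map f = OrderModule.map g := congrArg (fun φ => φ.hom.hom) h
    refine hom_ext (fun n => ?_) fun w => ?_
    · exact congrArg (fun φ : D.OrderModule →ₗ[gelfandOrder] E.OrderModule =>
        OrderModule.toN E (φ (OrderModule.inN D n))) h2
    · exact congrArg (fun φ : D.OrderModule →ₗ[gelfandOrder] E.OrderModule =>
        OrderModule.toW E (φ (OrderModule.inW D w))) h2

instance : toRepA.{u}.Full where
  map_surjective {D E} g := by
    obtain ⟨f, hf⟩ := OrderModule.exists_map_eq g.hom.hom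
    refine ⟨f, ?_⟩
    apply ObjectProperty.hom_ext
    exact ModuleCat.hom_ext hf

end GelfandDatum

/-! ## Every finite-dimensional module comes from a Gelfand datum -/

section

open gelfandOrder

variable (V : Type u) [AddCommGroup V] [Module ℝ V] [Module gelfandOrder V]
  [IsScalarTower ℝ gelfandOrder V]

/-- The action of an element of the Gelfand order as a real-linear map. -/
def orderAct (a : gelfandOrder) : V →ₗ[ℝ] V := Algebra.lsmul ℝ ℝ V a

variable {V}

theorem orderAct_apply (a : gelfandOrder) (v : V) : orderAct V a v = a • v := rfl

theorem mem_ker_genE {v : V} : v ∈ LinearMap.ker (orderAct V genE) ↔ genE • v = 0 := by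
  rw [LinearMap.mem_ker, orderAct_apply]

theorem mem_ker_one_sub_genE {v : V} :
    v ∈ LinearMap.ker (orderAct V (1 - genE)) ↔ genE • v = v := by
  rw [LinearMap.mem_ker, orderAct_apply, sub_smul, one_smul, sub_eq_zero, eq_comm]

variable (V) in
/-- The Gelfand datum of a module over the Gelfand order. -/
def orderDatum [FiniteDimensional ℝ V] : GelfandDatum.{u} where
  N0 := LinearMap.ker (orderAct V (1 - genE))
  W := LinearMap.ker (orderAct V genE)
  J := (orderAct V genJ).restrict fun v _ => by
    rw [mem_ker_genE, orderAct_apply, ← mul_smul, genE_mul_genJ, zero_smul]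
  P := (orderAct V genP).restrict fun v _ => by
    rw [mem_ker_genE, orderAct_apply, ← mul_smul, genE_mul_genP, zero_smul]
  Q := (orderAct V genQ).restrict fun v _ => by
    rw [mem_ker_one_sub_genE, orderAct_apply, ← mul_smul, genE_mul_genQ]
  J_J w := Subtype.ext <| by
    change genJ • genJ • (w : V) = -(w : V)
    rw [← mul_smul, genJ_mul_genJ, sub_smul, mem_ker_genE.1 w.2, one_smul, zero_sub]
  Q_J_P n := Subtype.ext <| by
    change genQ • genJ • genP • (n : V) = 0
    rw [← mul_smul, ← mul_smul, mul_assoc, genQ_mul_genJ_mul_genP, zero_smul]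
  nilpotent := by
    obtain ⟨m, hm⟩ := exists_scal_X_pow_smul V
    refine ⟨m, fun n => Subtype.ext ?_⟩
    -- On the image of e, QP is multiplication by X, because `genQ * genP` is X times e.
    have h (k : ℕ) (n : LinearMap.ker (orderAct V (1 - genE))) :
        (((((orderAct V genQ).restrict fun v _ => by
          rw [mem_ker_one_sub_genE, orderAct_apply, ← mul_smul, genE_mul_genQ]) ∘ₗ
          ((orderAct V genP).restrict fun v _ => by
          rw [mem_ker_genE, orderAct_apply, ← mul_smul, genE_mul_genP, zero_smul]) :
            Module.End ℝ (LinearMap.ker (orderAct V (1 - genE)))) ^ k) n : V) =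
          scal (PowerSeries.X ^ k) • (n : V) := by
      induction k generalizing n with
      | zero => simp
      | succ k ih =>
        rw [pow_succ, Module.End.mul_apply, ih]
        change _ • genQ • genP • (n : V) = _
        rw [← mul_smul genQ, genQ_mul_genP, mul_smul, mem_ker_one_sub_genE.1 n.2, ← mul_smul,
          ← map_mul, pow_succ]
    exact (h m n).trans (hm n)

theorem nonempty_orderModule_equiv [FiniteDimensional ℝ V] (D : GelfandDatum.{u})
    (onW : D.W →ₗ[ℝ] V) (onN : D.N0 →ₗ[ℝ] V) (hbij : Function.Bijective (onW.coprod onN))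
    (hE : ∀ w, genE • onW w = 0) (hE' : ∀ n, genE • onN n = onN n)
    (hJ : ∀ w, genJ • onW w = onW (D.J w)) (hP : ∀ n, genP • onN n = onW (D.P n))
    (hQ : ∀ w, genQ • onW w = onN (D.Q w)) :
    Nonempty (D.OrderModule ≃ₗ[gelfandOrder] V) := by
  have hJ' (n : D.N0) : genJ • onN n = 0 := by
    rw [← hE', ← mul_smul, genJ_mul_genE, zero_smul]
  have hP' (w : D.W) : genP • onW w = 0 := by
    rw [← genP_mul_genE, mul_smul, hE, smul_zero]
  have hQ' (n : D.N0) : genQ • onN n = 0 := by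
    rw [← hE', ← mul_smul, genQ_mul_genE, zero_smul]
  let f : D.OrderModule →ₗ[ℝ] V := onW.coprod onN
  let F : D.OrderModule →ₗ[gelfandOrder] V :=
    { toFun := f
      map_add' := map_add f
      map_smul' := map_smul_of_generators f
        (fun v => by
          rw [GelfandDatum.OrderModule.genE_smul]
          change onW 0 + onN v.2 = genE • (onW v.1 + onN v.2)
          rw [smul_add, hE, hE', map_zero])
        (fun v => by
          rw [GelfandDatum.OrderModule.genJ_smul]
          change onW (D.J v.1) + onN 0 = genJ • (onW v.1 + onN v.2)
          rw [smul_add, hJ, hJ', map_zero])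
        (fun v => by
          rw [GelfandDatum.OrderModule.genP_smul]
          change onW (D.P v.2) + onN 0 = genP • (onW v.1 + onN v.2)
          rw [smul_add, hP, hP', map_zero, add_zero, zero_add])
        (fun v => by
          rw [GelfandDatum.OrderModule.genQ_smul]
          change onW 0 + onN (D.Q v.1) = genQ • (onW v.1 + onN v.2)
          rw [smul_add, hQ, hQ', map_zero, add_zero, zero_add]) }
  exact ⟨LinearEquiv.ofBijective F hbij⟩

variable (V) in
-- This is the Peirce decomposition v = (1 - e)v + ev.
theorem nonempty_orderDatum_equiv [FiniteDimensional ℝ V] :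
    Nonempty ((orderDatum V).OrderModule ≃ₗ[gelfandOrder] V) := by
  refine nonempty_orderModule_equiv (orderDatum V) (LinearMap.ker (orderAct V genE)).subtype
    (LinearMap.ker (orderAct V (1 - genE))).subtype ⟨?_, fun v => ?_⟩
    (fun w => mem_ker_genE.1 w.2) (fun n => mem_ker_one_sub_genE.1 n.2) (fun _ => rfl)
    (fun _ => rfl) (fun _ => rfl)
  · rw [← LinearMap.ker_eq_bot, LinearMap.ker_eq_bot']
    rintro ⟨(w : LinearMap.ker (orderAct V genE)), (n : LinearMap.ker (orderAct V (1 - genE)))⟩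
      (h : (w : V) + (n : V) = 0)
    have h2 := congrArg (fun v => genE • v) h
    simp only [smul_add, mem_ker_genE.1 w.2, mem_ker_one_sub_genE.1 n.2, zero_add, smul_zero] at h2
    rw [h2, add_zero] at h
    exact Prod.ext (Subtype.ext h) (Subtype.ext h2)
  · refine ⟨(⟨(1 - genE) • v, ?_⟩, ⟨genE • v, ?_⟩), ?_⟩
    · rw [mem_ker_genE, ← mul_smul, mul_sub, genE_mul_genE, mul_one, sub_self, zero_smul]
    · rw [mem_ker_one_sub_genE, ← mul_smul, genE_mul_genE]
    · change (1 - genE) • v + genE • v = v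
      rw [← add_smul, sub_add_cancel, one_smul]

end

namespace GelfandDatum

instance : toRepA.{u}.EssSurj where
  mem_essImage N := by
    have : FiniteDimensional ℝ N.obj := N.property
    obtain ⟨e⟩ := nonempty_orderDatum_equiv N.obj
    exact ⟨orderDatum N.obj, ⟨isFiniteDimensional.isoMk e.toModuleIso⟩⟩

instance : toRepA.{u}.IsEquivalence where

end GelfandDatum

/-! ## The categories are abelian -/

instance : isFiniteDimensional.{u}.ContainsZero where
  exists_zero := ⟨ModuleCat.of gelfandOrder PUnit, ModuleCat.isZero_of_subsingleton _,
    Module.Finite.of_finite⟩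

instance : isFiniteDimensional.{u}.IsClosedUnderSubobjects where
  prop_of_mono {X Y} f _ hY := by
    have : FiniteDimensional ℝ Y := hY
    exact FiniteDimensional.of_injective (f.hom.restrictScalars ℝ)
      ((ModuleCat.mono_iff_injective f).1 inferInstance)

instance : isFiniteDimensional.{u}.IsClosedUnderQuotients where
  prop_of_epi {X Y} f _ hX := by
    have : FiniteDimensional ℝ X := hX
    exact Module.Finite.of_surjective (f.hom.restrictScalars ℝ)
      ((ModuleCat.epi_iff_surjective f).1 inferInstance)

instance : isFiniteDimensional.{u}.IsClosedUnderFiniteProducts where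
  isClosedUnderLimitsOfShape J _ :=
    { limitsOfShape_le := by
        rintro X ⟨p⟩
        have h (j : J) : FiniteDimensional ℝ (p.diag.obj ⟨j⟩) := p.prop_diag_obj ⟨j⟩
        let f : X →ₗ[ℝ] (∀ j : J, p.diag.obj ⟨j⟩) :=
          LinearMap.pi fun j => (p.π.app ⟨j⟩).hom.restrictScalars ℝ
        -- The common kernel of the projections is zero by the uniqueness of maps into a product, so
        -- X embeds in a finite product of finite-dimensional spaces.
        let L : Submodule gelfandOrder X := ⨅ j : J, LinearMap.ker (p.π.app ⟨j⟩).hom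
        have hL : ModuleCat.ofHom L.subtype = 0 := by
          refine p.isLimit.hom_ext fun ⟨j⟩ => ModuleCat.hom_ext (LinearMap.ext fun v => ?_)
          rw [Limits.zero_comp]
          exact LinearMap.mem_ker.1 ((Submodule.mem_iInf _).1 v.2 j)
        refine FiniteDimensional.of_injective f ?_
        rw [← LinearMap.ker_eq_bot, LinearMap.ker_eq_bot']
        intro v hv
        have hvL : v ∈ L := (Submodule.mem_iInf _).2 fun j => congrFun hv j
        exact congrArg (fun g : ModuleCat.of gelfandOrder L ⟶ X => g.hom ⟨v, hvL⟩) hL }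

end RealGelfand

end

theorem theoremT :
    (∃ h : Abelian RealGelfand.PrincipalBlock.{u},
      h.toPreadditive = (inferInstance : Preadditive RealGelfand.PrincipalBlock.{u})) ∧
    (∃ h : Abelian RealGelfand.RepA.{u},
      h.toPreadditive = (inferInstance : Preadditive RealGelfand.RepA.{u})) ∧
    ∃ e : RealGelfand.PrincipalBlock.{u} ≌ RealGelfand.RepA.{u},
      e.functor.Additive ∧ e.functor.Linear ℝ := by
  let F := RealGelfand.GelfandDatum.toPrincipalBlock.{u}.asEquivalence
  let G := RealGelfand.GelfandDatum.toRepA.{u}.asEquivalence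
  have : F.functor.Additive :=
    inferInstanceAs RealGelfand.GelfandDatum.toPrincipalBlock.{u}.Additive
  have : G.functor.Additive := inferInstanceAs RealGelfand.GelfandDatum.toRepA.{u}.Additive
  have : F.functor.Linear ℝ :=
    inferInstanceAs (RealGelfand.GelfandDatum.toPrincipalBlock.{u}.Linear ℝ)
  have : G.functor.Linear ℝ := inferInstanceAs (RealGelfand.GelfandDatum.toRepA.{u}.Linear ℝ)
  let e := F.symm.trans G
  have h1 : e.functor.Additive := inferInstanceAs (F.inverse ⋙ G.functor).Additive
  have h2 : e.functor.Linear ℝ := inferInstanceAs ((F.inverse ⋙ G.functor).Linear ℝ)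
  -- Transport of the abelian structure presupposes finite products, which are themselves
  -- transported along the equivalence.
  have : Limits.HasFiniteProducts RealGelfand.PrincipalBlock.{u} :=
    ⟨fun _ => Adjunction.hasLimitsOfShape_of_equivalence e.functor⟩
  exact ⟨⟨abelianOfEquivalence e.functor, rfl⟩, ⟨inferInstance, rfl⟩, e, h1, h2⟩
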